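/- Let $d\ge 1$ and let $\omega=(\omega_1,\dots,\omega_d)\in\mathbb{R}^d$ be such that $1,\omega_1,\dots,\omega_d$ form a $\mathbb{Q}$-basis of a number field $\Phi\subset\mathbb{R}$. Let $r$ be the rank of the group $\mathbb{Z}_\Phi^\times$ of units of the ring of integers of $\Phi$. Let $R\subset\mathbb{R}^d$ be a bounded convex set with non-empty interior. For $t\ge 1$ put $M(t)=tR\cap\mathbb{Z}^d$, let $y_1(t)\le\dots\le y_{|M(t)|}(t)$ be the fractional parts $\{m\cdot\omega\}$, $m\in M(t)$, in increasing order, and put $\delta_i(t)=y_{i+1}(t)-y_i(t)$ for $1\le i\le |M(t)|-1$ and $\rho_i(t)=\delta_i(t)/\delta_{i-1}(t)$ for $2\le i\le |M(t)|-1$. Then: (1) There is a finite set $\mathcal{R}=\{r_1,\dots,r_J\}\subset\Phi$ (with $r_1,\dots,r_J$ distinct), not depending on $t$, such that $\rho_i(t)\in\mathcal{R}$ for all $t>1$ and all $2\le i\le |M(t)|-1$. (2) For $1\le j\le J$ and $t>1$ with $|M(t)|\ge 3$, let $p_j(t)$ be the proportion of the $|M(t)|-2$ ratios $\rho_i(t)$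 that are equal to $r_j$. Then there are an integer $0\le k\le d+1$, a Lipschitz continuous function $$h:\mathbb{T}^k\times[0,1]^r\to P:=\Big\{(p_1,\dots,p_J)\in\mathbb{R}^J:\ p_j\ge 0,\ \sum_{j} p_j=1\Big\},\qquad \mathbb{T}=\mathbb{R}/\mathbb{Z},$$ numbers $\theta=(\theta_1,\dots,\theta_k)\in\mathbb{R}^k$ and $\beta=(\beta_1,\dots,\beta_r)\in\mathbb{R}^r$, and $0<\alpha<1$, such that $$(p_1(t),\dots,p_J(t))=h\big(\theta\log t,\{\beta\log t\}\big)+O(\alpha^{\log t})$$ for all $t>1$ with $|M(t)|\ge 3$, where the implied constant does not depend on $t$, $\theta\log t$ is taken modulo $\mathbb{Z}^k$, and $\{\beta\log t\}=(\{\beta_1\log t\},\dots,\{\beta_r\log t\})$ is the vector of fractional parts. -/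

import Mathlib

open scoped Pointwise NumberField NNReal

noncomputable section

namespace Spacings

/-- The integer points of a bounded set are finite in number. -/
theorem latticePoints_finite {d : ℕ} {R : Set (Fin d → ℝ)} (hR : Bornology.IsBounded R) (t : ℝ) :
    {m : Fin d → ℤ | (fun i => (m i : ℝ)) ∈ t • R}.Finite := by
  obtain ⟨C, hC⟩ := (hR.smul₀ t).exists_norm_le
  refine (Set.finite_Icc (fun _ : Fin d => -⌈C⌉) (fun _ => ⌈C⌉)).subset fun m hm => ?_
  have h : ∀ i, |(m i : ℝ)| ≤ C := fun i =>
    (norm_le_pi_norm (fun i => (m i : ℝ)) i).trans (hC _ hm)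
  refine ⟨fun i => ?_, fun i => ?_⟩
  · have h1 := (abs_le.1 (h i)).1
    have h2 := Int.le_ceil C
    have h3 : (-(⌈C⌉ : ℝ)) ≤ m i := by linarith
    exact_mod_cast h3
  · have h1 := (abs_le.1 (h i)).2
    have h2 := Int.le_ceil C
    have h3 : (m i : ℝ) ≤ ⌈C⌉ := by linarith
    exact_mod_cast h3

variable {d : ℕ}

/-- `M(t) = R(t) ∩ ℤ^d`, where `R(t) = t • R` is the dilation of the bounded region `R`
about the origin. -/
def M {R : Set (Fin d → ℝ)} (hR : Bornology.IsBounded R) (t : ℝ) : Finset (Fin d → ℤ) :=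
  (latticePoints_finite hR t).toFinset

/-- The fractional part `{m ⬝ ω}`. -/
def fracDot (ω : Fin d → ℝ) (m : Fin d → ℤ) : ℝ :=
  Int.fract (∑ i, (m i : ℝ) * ω i)

/-- The numbers `{m ⬝ ω}`, `m ∈ M(t)`, listed in increasing order (a list of length `|M(t)|`). -/
def points (ω : Fin d → ℝ) {R : Set (Fin d → ℝ)} (hR : Bornology.IsBounded R) (t : ℝ) : List ℝ :=
  ((M hR t).val.map (fracDot ω)).sort

/-- The point `y` with index `i`; indices start at `0`, so that this is meaningful
for `i < |M(t)|`. -/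
def y (ω : Fin d → ℝ) {R : Set (Fin d → ℝ)} (hR : Bornology.IsBounded R) (t : ℝ) (i : ℕ) : ℝ :=
  (points ω hR t).getD i 0

/-- The spacing `y_{i+1}(t) - y_i(t)`, meaningful for `i + 1 < |M(t)|`. -/
def gap (ω : Fin d → ℝ) {R : Set (Fin d → ℝ)} (hR : Bornology.IsBounded R) (t : ℝ) (i : ℕ) : ℝ :=
  y ω hR t (i + 1) - y ω hR t i

/-- The ratio of two neighbouring spacings (the later one over the earlier one), meaningful for
`i + 2 < |M(t)|`; thus there are `|M(t)| - 2` ratios at scale `t`. -/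
def gapRatio (ω : Fin d → ℝ) {R : Set (Fin d → ℝ)} (hR : Bornology.IsBounded R) (t : ℝ) (i : ℕ) :
    ℝ :=
  gap ω hR t (i + 1) / gap ω hR t i

/-- The proportion of the `|M(t)| - 2` ratios of neighbouring spacings that are equal to `x`
(meaningful when `3 ≤ |M(t)|`). -/
def proportion (ω : Fin d → ℝ) {R : Set (Fin d → ℝ)} (hR : Bornology.IsBounded R) (t : ℝ)
    (x : ℝ) : ℝ :=
  (((Finset.range ((M hR t).card - 2)).filter fun i => gapRatio ω hR t i = x).card : ℝ) /
    (((M hR t).card - 2 : ℕ) : ℝ)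

/-- The fractional part as a point of `[0,1]`. -/
def fractI (x : ℝ) : unitInterval :=
  ⟨Int.fract x, Int.fract_nonneg x, (Int.fract_lt_one x).le⟩

end Spacings

end

/-! The points `{m ⬝ ω}`, `m ∈ M(t)`, are the elements of the lattice `L = ℤ + ℤω₁ + ⋯ + ℤω_d` in
`[0, 1)` whose last `d` coordinates lie in `tR`. The spacing after such a point is therefore the
least positive `μ ∈ L` whose coordinate vector, divided by `t`, moves `p = m / t` to a point of the
window `R`; for the preceding spacing the displacement is reversed. Through the trace dual basis the
displacement is a linear form in the conjugates `σ a`, with a weight `z σ` for each complex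
embedding; initially `z = 1 / t`.

Multiplication by a positive unit `u` with `uL = L` leaves the ratios unchanged and replaces `z σ`
by `z σ * σ u` (`hasRatio_comp_mul`, `disp_mul`). By Dirichlet's unit theorem `u` can be chosen with
`|σ u|` comparable to `t` at every embedding except the inclusion; since the norm of `u` is `±1`,
the weight at the inclusion is then `O(1 / t)`. Replacing that weight by `0` gives a point of a
family of scales parametrised by a torus, for the arguments, which are linear in `log t`, and a
cube, for the fractional parts left when the exponents of the units are rounded
(`exists_scale_family`). For weights that are bounded above and below off the inclusion and small at
it, all neighbours lie in one finite set `F` (`exists_hasNeighbours_disp`), so only finitely many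
ratios occur.

The ratio at `p ∈ R` depends only on which of the finitely many points `p ± f μ`, `μ ∈ F`, lie in
`R`. A `δ`-neighbourhood of the boundary of a bounded convex set has volume `O(δ)`
(`measureReal_nearBoundary_le`). Hence the volume of the set of `p` with a given ratio is Lipschitz
in the scale, and counting the points of `t⁻¹ℤ^d` in it gives `t^d` times this volume with relative
error `O(1 / t)`. The function `h` is this volume divided by that of `R`, and `α = e⁻¹`, because `α
^ log t = 1 / t`. -/

noncomputable section

namespace Spacings

open MeasureTheory

/-! ### Volume near the boundary of a convex set. -/

section Geometry

variable {E : Type*} [NormedAddCommGroup E]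

/-- The points with both a point of `R` and a point of the complement of `R` within distance `δ`. -/
def nearBoundary (R : Set E) (δ : ℝ) : Set E :=
  {p | ∃ a ∈ R, ∃ c ∉ R, dist a p ≤ δ ∧ dist c p ≤ δ}

theorem nearBoundary_mono (R : Set E) {δ δ' : ℝ} (h : δ ≤ δ') :
    nearBoundary R δ ⊆ nearBoundary R δ' := fun _ ⟨a, ha, c, hc, h1, h2⟩ =>
  ⟨a, ha, c, hc, h1.trans h, h2.trans h⟩

theorem nearBoundary_subset_cthickening (R : Set E) (δ : ℝ) :
    nearBoundary R δ ⊆ Metric.cthickening δ R := fun p ⟨a, ha, _, _, h, _⟩ =>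
  Metric.mem_cthickening_of_dist_le p a δ R ha (by rwa [dist_comm])

theorem isBounded_nearBoundary {R : Set E} (hR : Bornology.IsBounded R) (δ : ℝ) :
    Bornology.IsBounded (nearBoundary R δ) :=
  hR.cthickening.subset (nearBoundary_subset_cthickening R δ)

theorem one_add_pow_le (n : ℕ) {s : ℝ} (h0 : 0 ≤ s) (h1 : s ≤ 1) :
    (1 + s) ^ n ≤ 1 + (2 ^ n - 1) * s := by
  induction n with
  | zero => simp
  | succ n ih =>
    have h2 : (1 : ℝ) ≤ 2 ^ n := one_le_pow₀ (by norm_num)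
    have h3 : s * s ≤ s := by nlinarith
    calc (1 + s) ^ (n + 1) = (1 + s) ^ n * (1 + s) := pow_succ _ _
      _ ≤ (1 + (2 ^ n - 1) * s) * (1 + s) := by gcongr
      _ = 1 + s + (2 ^ n - 1) * s + (2 ^ n - 1) * (s * s) := by ring
      _ ≤ 1 + s + (2 ^ n - 1) * s + (2 ^ n - 1) * s := by
          have := mul_le_mul_of_nonneg_left h3 (sub_nonneg.2 h2); linarith
      _ = _ := by rw [pow_succ]; ring

variable [NormedSpace ℝ E]

/-- A vector of norm at most `ρ * s` is `s` times a vector of the ball of radius `ρ`. So moving a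
point of `R` by it amounts to a convex combination with a point of the ball, up to a dilation by `1
+ s` about `q`; starting in the copy of `R` shrunk by `1 - s`, no dilation is needed and the result
stays in `R`. -/
theorem nearBoundary_subset_homothety {R : Set E} (hc : Convex ℝ R) {q : E} {ρ : ℝ}
    (hball : Metric.closedBall q ρ ⊆ R) {s : ℝ} (hs0 : 0 < s) (hs1 : s < 1) :
    nearBoundary R (ρ * s) ⊆
      AffineMap.homothety q (1 + s) '' R \ AffineMap.homothety q (1 - s) '' R := by
  have key : ∀ e : E, ‖e‖ ≤ ρ * s → q + s⁻¹ • e ∈ R := fun e he => hball (by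
    rw [Metric.mem_closedBall, dist_eq_norm, add_sub_cancel_left, norm_smul, norm_inv,
      Real.norm_of_nonneg hs0.le, inv_mul_le_iff₀ hs0]
    linarith)
  rintro p ⟨a, ha, c, hcR, hap, hcp⟩
  constructor
  · have h1 := key (p - a) (by rwa [← dist_eq_norm, dist_comm])
    have h2 : (0 : ℝ) < 1 + s := by linarith
    refine ⟨(1 + s)⁻¹ • a + (s * (1 + s)⁻¹) • (q + s⁻¹ • (p - a)),
      hc ha h1 (by positivity) (by positivity) (by field_simp), ?_⟩
    simp only [AffineMap.homothety_apply, vsub_eq_sub, vadd_eq_add]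
    have e1 : (1 + s) * (1 + s)⁻¹ = 1 := mul_inv_cancel₀ h2.ne'
    have e2 : (1 + s) * (s * (1 + s)⁻¹) = s := by field_simp
    rw [smul_sub, smul_add, smul_smul, smul_smul, e1, e2, smul_add, smul_smul,
      mul_inv_cancel₀ hs0.ne', one_smul, one_smul, add_smul, one_smul]
    abel
  · rintro ⟨x, hx, rfl⟩
    apply hcR
    have h1 := key (c - AffineMap.homothety q (1 - s) x) (by rwa [← dist_eq_norm])
    have h2 := hc hx h1 (sub_pos.2 hs1).le hs0.le (by ring)
    convert h2 using 1
    rw [smul_add, smul_smul, mul_inv_cancel₀ hs0.ne', one_smul]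
    simp only [AffineMap.homothety_apply, vsub_eq_sub, vadd_eq_add, smul_sub, sub_smul, one_smul]
    abel

variable [MeasurableSpace E] [BorelSpace E] [FiniteDimensional ℝ E] (μ : Measure E)
  [μ.IsAddHaarMeasure]

/-- The measure of the `δ`-neighbourhood of the boundary of a bounded convex set with non-empty
interior is `O(δ)`. -/
theorem measureReal_nearBoundary_le {R : Set E} (hb : Bornology.IsBounded R) (hc : Convex ℝ R)
    (hi : (interior R).Nonempty) :
    ∃ K : ℝ, 0 ≤ K ∧ ∀ δ : ℝ, 0 ≤ δ → δ ≤ 2 → μ.real (nearBoundary R δ) ≤ K * δ := by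
  obtain ⟨q, hq⟩ := hi
  obtain ⟨ρ', hρ', hball'⟩ := Metric.isOpen_iff.1 isOpen_interior q hq
  set ρ := ρ' / 2 with hρdef
  have hρ : 0 < ρ := by positivity
  have hball : Metric.closedBall q ρ ⊆ R :=
    (Metric.closedBall_subset_ball (by rw [hρdef]; linarith)).trans
      (hball'.trans interior_subset)
  set n := Module.finrank ℝ E
  set V := μ.real R
  have hV : 0 ≤ V := measureReal_nonneg
  have hRfin : μ R ≠ ⊤ := hb.measure_lt_top.ne
  have hn2 : (1 : ℝ) ≤ 2 ^ n := one_le_pow₀ (by norm_num)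
  have hW : 0 ≤ μ.real (nearBoundary R 2) := measureReal_nonneg
  -- The first term comes from `(1 + s) ^ n - (1 - s) ^ n ≤ (2 ^ n - 1 + n) * s` and serves `δ < ρ`.
  -- The second serves `ρ ≤ δ ≤ 2`, where `δ / ρ ≥ 1` and monotonicity suffices.
  refine ⟨(2 ^ n - 1 + n) * V / ρ + μ.real (nearBoundary R 2) / ρ, ?_, fun δ hδ0 hδ2 => ?_⟩
  · have := sub_nonneg.2 hn2
    positivity
  have hmain : 0 ≤ (2 ^ n - 1 + n : ℝ) * V / ρ := by
    have := sub_nonneg.2 hn2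
    positivity
  rcases lt_or_ge δ ρ with hδ | hδ
  · rcases hδ0.eq_or_lt with rfl | hδpos
    · have : nearBoundary R 0 = ∅ := by
        ext p
        simp only [nearBoundary, Set.mem_ofPred_eq, Set.mem_empty_iff_false, iff_false]
        rintro ⟨a, ha, c, hcR, h1, h2⟩
        have h1' := dist_le_zero.1 h1
        have h2' := dist_le_zero.1 h2
        exact hcR (by rw [h2', ← h1']; exact ha)
      simp [this]
    set s := δ / ρ with hs
    have hs0 : 0 < s := by positivity
    have hs1 : s < 1 := (div_lt_one hρ).2 hδ
    have hδs : δ = ρ * s := by rw [hs]; field_simp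
    have hsub := nearBoundary_subset_homothety hc hball hs0 hs1
    rw [← hδs] at hsub
    set A := AffineMap.homothety q (1 + s) '' R
    set B := AffineMap.homothety q (1 - s) '' R
    have hA : μ.real A = (1 + s) ^ n * V := by
      simp only [A, measureReal_def, Measure.addHaar_image_homothety, ENNReal.toReal_mul]
      rw [ENNReal.toReal_ofReal (abs_nonneg _), abs_of_nonneg (by positivity)]
      rfl
    have hB : μ.real B = (1 - s) ^ n * V := by
      simp only [B, measureReal_def, Measure.addHaar_image_homothety, ENNReal.toReal_mul]
      rw [ENNReal.toReal_ofReal (abs_nonneg _),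
        abs_of_nonneg (pow_nonneg (by linarith) _)]
      rfl
    have hAfin : μ A ≠ ⊤ := by
      simp only [A, Measure.addHaar_image_homothety]
      exact ENNReal.mul_ne_top ENNReal.ofReal_ne_top hRfin
    have hqR : q ∈ R := hball (Metric.mem_closedBall_self hρ.le)
    have hBA : B ⊆ A := by
      rintro _ ⟨x, hx, rfl⟩
      have h2 : (0 : ℝ) < 1 + s := by linarith
      refine ⟨((1 - s) / (1 + s)) • x + (1 - (1 - s) / (1 + s)) • q,
        hc hx hqR (div_nonneg (by linarith) h2.le)
          (sub_nonneg.2 ((div_le_one h2).2 (by linarith))) (by ring), ?_⟩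
      simp only [AffineMap.homothety_apply, vsub_eq_sub, vadd_eq_add]
      have e1 : (1 + s) * ((1 - s) / (1 + s)) = 1 - s := by field_simp
      have e2 : (1 + s) * (1 - (1 - s) / (1 + s)) = 1 + s - (1 - s) := by field_simp
      rw [smul_sub, smul_add, smul_smul, smul_smul, e1, e2, sub_smul (1 + s) (1 - s) q, smul_sub]
      abel
    have hBn : NullMeasurableSet B μ := (hc.affine_image _).nullMeasurableSet μ
    have hdiff : μ.real (A \ B) = μ.real A - μ.real B := by
      rw [measureReal_def, measure_sdiff hBA hBn (measure_ne_top_of_subset hBA hAfin),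
        ENNReal.toReal_sub_of_le (measure_mono hBA) hAfin]
      rfl
    have hmono : μ.real (nearBoundary R δ) ≤ μ.real (A \ B) :=
      measureReal_mono hsub (measure_ne_top_of_subset Set.sdiff_subset hAfin)
    have hb1 := one_add_pow_le n hs0.le hs1.le
    have hb2 : 1 + (n : ℝ) * (-s) ≤ (1 + -s) ^ n := one_add_mul_le_pow (by linarith) n
    have hb3 : (1 - s) ^ n = (1 + -s) ^ n := by ring
    calc μ.real (nearBoundary R δ) ≤ ((1 + s) ^ n - (1 - s) ^ n) * V := by
          rw [sub_mul, ← hA, ← hB, ← hdiff]; exact hmono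
      _ ≤ ((2 ^ n - 1 + n) * s) * V := by gcongr; rw [hb3]; linarith
      _ = (2 ^ n - 1 + n) * V / ρ * δ := by rw [hs]; ring
      _ ≤ _ := by
          gcongr
          have : 0 ≤ μ.real (nearBoundary R 2) / ρ := by positivity
          linarith
  · have h1 : μ.real (nearBoundary R δ) ≤ μ.real (nearBoundary R 2) :=
      measureReal_mono (nearBoundary_mono R hδ2) (isBounded_nearBoundary hb 2).measure_lt_top.ne
    have h2 : μ.real (nearBoundary R 2) ≤ μ.real (nearBoundary R 2) / ρ * δ := by
      rw [div_mul_eq_mul_div, le_div_iff₀ hρ]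
      gcongr
    rw [add_mul]
    have := mul_nonneg hmain hδ0
    linarith

end Geometry

end Spacings

end

noncomputable section

namespace Spacings

open MeasureTheory

/-! ### Neighbours and ratios for an abstract displacement. -/

section Neighbours

variable {Φ : IntermediateField ℚ ℝ} {E : Type*} [NormedAddCommGroup E]

/-- `μ` is the least positive element of `L` whose displacement `f μ` moves `p` into `R`. -/
def IsNext (L : AddSubgroup Φ) (R : Set E) (f : Φ → E) (p : E) (μ : Φ) : Prop :=
  μ ∈ L ∧ 0 < (μ : ℝ) ∧ p + f μ ∈ R ∧
    ∀ ν ∈ L, 0 < (ν : ℝ) → p + f ν ∈ R → (μ : ℝ) ≤ ν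

/-- The next spacing at `p` is `x` times the preceding one. -/
def HasRatio (L : AddSubgroup Φ) (R : Set E) (f : Φ → E) (p : E) (x : Φ) : Prop :=
  ∃ μ μ' : Φ, IsNext L R f p μ ∧ IsNext L R (-f) p μ' ∧ μ = x * μ'

/-- At all points of `R` the next spacing and the preceding one exist and lie in `F`. -/
def HasNeighbours (F : Finset Φ) (L : AddSubgroup Φ) (R : Set E) (f : Φ → E) : Prop :=
  ∀ p ∈ R, (∃ μ ∈ F, IsNext L R f p μ) ∧ ∃ μ ∈ F, IsNext L R (-f) p μ

/-- The points of `R` at which the ratio of neighbouring spacings is `x`. -/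
def ratioSet (L : AddSubgroup Φ) (R : Set E) (f : Φ → E) (x : Φ) : Set E :=
  {p | p ∈ R ∧ HasRatio L R f p x}

/-- The quotients of two elements of `F`. -/
def quotients (F : Finset Φ) : Finset Φ :=
  (F ×ˢ F).image fun a => a.1 / a.2

variable {F : Finset Φ} {L : AddSubgroup Φ} {R : Set E} {f g : Φ → E} {p q : E} {μ μ' x x' : Φ}

theorem IsNext.unique (h : IsNext L R f p μ) (h' : IsNext L R f p μ') : μ = μ' :=
  Subtype.ext (le_antisymm (h.2.2.2 _ h'.1 h'.2.1 h'.2.2.1) (h'.2.2.2 _ h.1 h.2.1 h.2.2.1))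

theorem IsNext.ne_zero (h : IsNext L R f p μ) : μ ≠ 0 := by
  rintro rfl
  exact lt_irrefl _ h.2.1

theorem HasRatio.unique (h : HasRatio L R f p x) (h' : HasRatio L R f p x') : x = x' := by
  obtain ⟨μ, ν, h1, h2, h3⟩ := h
  obtain ⟨μ', ν', h1', h2', h3'⟩ := h'
  obtain rfl := h1.unique h1'
  obtain rfl := h2.unique h2'
  exact mul_right_cancel₀ h2.ne_zero (h3.symm.trans h3')

theorem HasNeighbours.exists_hasRatio (h : HasNeighbours F L R f) (hp : p ∈ R) :
    ∃ x ∈ quotients F, HasRatio L R f p x := by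
  obtain ⟨⟨μ, hμF, hμ⟩, μ', hμF', hμ'⟩ := h p hp
  refine ⟨μ / μ', ?_, μ, μ', hμ, hμ', (div_mul_cancel₀ _ hμ'.ne_zero).symm⟩
  exact Finset.mem_image.2 ⟨(μ, μ'), Finset.mem_product.2 ⟨hμF, hμF'⟩, rfl⟩

/-- Each of `μ`, `μ'` is an admissible competitor in the minimality of the other. -/
theorem IsNext.congr (h : IsNext L R f p μ) (h' : IsNext L R g q μ') (hμ : μ ∈ F) (hμ' : μ' ∈ F)
    (hF : ∀ ν ∈ F, p + f ν ∈ R ↔ q + g ν ∈ R) : μ = μ' :=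
  Subtype.ext (le_antisymm (h.2.2.2 _ h'.1 h'.2.1 ((hF _ hμ').2 h'.2.2.1))
    (h'.2.2.2 _ h.1 h.2.1 ((hF _ hμ).1 h.2.2.1)))

/-- Minimality over all of `L` reduces to finitely many membership conditions, because the
minimisers are known to lie in `F`. -/
theorem HasNeighbours.hasRatio_of_hasRatio (hf : HasNeighbours F L R f)
    (hg : HasNeighbours F L R g) (hp : p ∈ R) (hq : q ∈ R)
    (h1 : ∀ ν ∈ F, p + f ν ∈ R ↔ q + g ν ∈ R)
    (h2 : ∀ ν ∈ F, p + (-f) ν ∈ R ↔ q + (-g) ν ∈ R) (h : HasRatio L R f p x) :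
    HasRatio L R g q x := by
  obtain ⟨⟨a, haF, ha⟩, a', haF', ha'⟩ := hf p hp
  obtain ⟨⟨c, hcF, hc⟩, c', hcF', hc'⟩ := hg q hq
  obtain ⟨μ, μ', hμ, hμ', e⟩ := h
  obtain rfl := ha.unique hμ
  obtain rfl := ha'.unique hμ'
  obtain rfl := ha.congr hc haF hcF h1
  obtain rfl := ha'.congr hc' haF' hcF' h2
  exact ⟨_, _, hc, hc', e⟩

/-- Multiplication by a positive element preserving `L` does not change the ratios. -/
theorem hasRatio_comp_mul {u : Φ} (hu : 0 < (u : ℝ)) (hL : ∀ a, u * a ∈ L ↔ a ∈ L) :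
    HasRatio L R (fun a => f (u * a)) p x ↔ HasRatio L R f p x := by
  have hu0 : u ≠ 0 := by rintro rfl; exact lt_irrefl _ hu
  -- Multiplication by `u` is an increasing bijection of the positive elements of `L`, so it carries
  -- minimisers to minimisers. The claim is for all `f`, being needed for `-f` as well.
  have key : ∀ (f : Φ → E) (μ : Φ),
      IsNext L R (fun a => f (u * a)) p μ ↔ IsNext L R f p (u * μ) := by
    intro f μ
    refine and_congr (hL μ).symm (and_congr ?_ (and_congr Iff.rfl ⟨fun h ν hν h0 hR => ?_,
      fun h ν hν h0 hR => ?_⟩))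
    · push_cast
      exact (mul_pos_iff_of_pos_left hu).symm
    · have e : u * (u⁻¹ * ν) = ν := mul_inv_cancel_left₀ hu0 ν
      have := h (u⁻¹ * ν) ((hL _).1 (by rwa [e])) (by push_cast; positivity)
        (by simpa only [e] using hR)
      push_cast at this ⊢
      rwa [inv_mul_eq_div, le_div_iff₀ hu, mul_comm] at this
    · have := h (u * ν) ((hL ν).2 hν) (by push_cast; positivity) hR
      push_cast at this
      exact le_of_mul_le_mul_left this hu
  constructor
  · rintro ⟨μ, μ', h, h', e⟩
    exact ⟨u * μ, u * μ', (key f μ).1 h, (key (-f) μ').1 h', by rw [e]; ring⟩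
  · rintro ⟨μ, μ', h, h', e⟩
    refine ⟨u⁻¹ * μ, u⁻¹ * μ', (key f _).2 ?_, (key (-f) _).2 ?_, by rw [e]; ring⟩
    · rwa [mul_inv_cancel_left₀ hu0]
    · rwa [mul_inv_cancel_left₀ hu0]

/-- Where `φ p` and `p`, with displacements `f` and `g`, give different ratios, one of finitely
many translates of `p` is near the boundary of `R`. -/
theorem ratioSet_diff_subset (hf : HasNeighbours F L R f) (hg : HasNeighbours F L R g) {δ : ℝ}
    (hfg : ∀ μ ∈ F, ‖f μ - g μ‖ ≤ δ) {φ : E → E} (hφ : ∀ p, ‖φ p - p‖ ≤ δ) (hδ : 0 ≤ δ)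
    (hpq : ¬ (φ p ∈ ratioSet L R f x ↔ p ∈ ratioSet L R g x)) :
    p ∈ nearBoundary R (2 * δ) ∨ (∃ μ ∈ F, p + g μ ∈ nearBoundary R (2 * δ)) ∨
      ∃ μ ∈ F, p + -g μ ∈ nearBoundary R (2 * δ) := by
  -- The radius `2 * δ` is one `δ` for moving the point and one for changing the displacement.
  have near : ∀ a c : E, ‖a - c‖ ≤ 2 * δ → ¬ (a ∈ R ↔ c ∈ R) → c ∈ nearBoundary R (2 * δ) := by
    intro a c hac h
    by_cases ha : a ∈ R
    · exact ⟨a, ha, c, fun hc => h (by simp [ha, hc]), by rwa [dist_eq_norm],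
        by simpa using hδ⟩
    · exact ⟨c, by_contra fun hc => h (by simp [ha, hc]), a, ha, by simpa using hδ,
        by rwa [dist_eq_norm]⟩
  by_contra! hcon
  obtain ⟨h0, h1, h2⟩ := hcon
  have e0 : φ p ∈ R ↔ p ∈ R := by
    by_contra h
    exact h0 (near _ _ ((hφ p).trans (by linarith)) h)
  have e1 : ∀ μ ∈ F, φ p + f μ ∈ R ↔ p + g μ ∈ R := by
    intro μ hμ
    by_contra h
    refine h1 μ hμ (near _ _ ?_ h)
    calc ‖φ p + f μ - (p + g μ)‖ = ‖(φ p - p) + (f μ - g μ)‖ := by congr 1; abel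
      _ ≤ δ + δ := norm_add_le_of_le (hφ p) (hfg μ hμ)
      _ = 2 * δ := by ring
  have e2 : ∀ μ ∈ F, φ p + (-f) μ ∈ R ↔ p + (-g) μ ∈ R := by
    intro μ hμ
    by_contra h
    refine h2 μ hμ (near _ _ ?_ h)
    calc ‖φ p + -f μ - (p + -g μ)‖ = ‖(φ p - p) - (f μ - g μ)‖ := by congr 1; abel
      _ ≤ δ + δ := norm_sub_le_of_le (hφ p) (hfg μ hμ)
      _ = 2 * δ := by ring
  exact hpq ⟨fun h => ⟨e0.1 h.1, hf.hasRatio_of_hasRatio hg h.1 (e0.1 h.1) e1 e2 h.2⟩,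
    fun h => ⟨e0.2 h.1, hg.hasRatio_of_hasRatio hf h.1 (e0.2 h.1) (fun ν hν => (e1 ν hν).symm)
      (fun ν hν => (e2 ν hν).symm) h.2⟩⟩

end Neighbours

/-! ### Measures of the sets with a given ratio. -/

section Volume

/-- A set that depends only on membership in the `A i` is a finite union of atoms of the Boolean
algebra they generate. -/
theorem nullMeasurableSet_of_forall_mem_iff {α ι : Type*} [MeasurableSpace α] {m : Measure α}
    [Finite ι] {A : ι → Set α} (hA : ∀ i, NullMeasurableSet (A i) m) {S : Set α}
    (hS : ∀ p q, (∀ i, p ∈ A i ↔ q ∈ A i) → p ∈ S → q ∈ S) : NullMeasurableSet S m := by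
  classical
  have e : S = ⋃ T ∈ (fun p => {i | p ∈ A i}) '' S,
      ⋂ i, if i ∈ T then A i else (A i)ᶜ := by
    ext q
    simp only [Set.mem_image, Set.iUnion_exists, Set.biUnion_and', Set.iUnion_iUnion_eq_right,
      Set.mem_iUnion, Set.mem_iInter, Set.mem_ofPred_eq]
    constructor
    · intro hq
      refine ⟨q, hq, fun i => ?_⟩
      split_ifs with h
      · exact h
      · exact h
    · rintro ⟨p, hp, h⟩
      refine hS p q (fun i => ?_) hp
      have := h i
      split_ifs at this with h'
      · exact ⟨fun _ => this, fun _ => h'⟩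
      · exact ⟨fun h => absurd h h', fun h => absurd h this⟩
  rw [e]
  refine NullMeasurableSet.biUnion (Set.to_countable _) fun T _ =>
    NullMeasurableSet.iInter fun i => ?_
  split_ifs
  exacts [hA i, (hA i).compl]

theorem abs_measureReal_sub_le {α : Type*} [MeasurableSpace α] {m : Measure α} {A B N : Set α}
    (hA : m A ≠ ⊤) (hB : m B ≠ ⊤) (hN : m N ≠ ⊤) (h : ∀ p, ¬ (p ∈ A ↔ p ∈ B) → p ∈ N) :
    |m.real A - m.real B| ≤ m.real N := by
  have h1 : m.real A ≤ m.real (B ∪ N) := measureReal_mono (fun p hp => by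
    by_cases hpB : p ∈ B
    · exact Or.inl hpB
    · exact Or.inr (h p (by simp [hp, hpB]))) (measure_union_ne_top hB hN)
  have h2 : m.real B ≤ m.real (A ∪ N) := measureReal_mono (fun p hp => by
    by_cases hpA : p ∈ A
    · exact Or.inl hpA
    · exact Or.inr (h p (by simp [hp, hpA]))) (measure_union_ne_top hA hN)
  have h3 := measureReal_union_le (μ := m) B N
  have h4 := measureReal_union_le (μ := m) A N
  rw [abs_le]
  constructor <;> linarith

theorem measureReal_preimage_add {E : Type*} [NormedAddCommGroup E] [MeasurableSpace E]
    [BorelSpace E] (m : Measure E) [m.IsAddRightInvariant] (S : Set E) (v : E) :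
    m.real {p | p + v ∈ S} = m.real S := by
  simp only [measureReal_def]
  congr 1
  exact measure_preimage_add_right m v S

variable {Φ : IntermediateField ℚ ℝ} {E : Type*} [NormedAddCommGroup E] [NormedSpace ℝ E]
  [MeasurableSpace E] [BorelSpace E] [FiniteDimensional ℝ E] (m : Measure E) [m.IsAddHaarMeasure]
  {F : Finset Φ} {L : AddSubgroup Φ} {R : Set E} {f : Φ → E}

theorem nullMeasurableSet_ratioSet (hc : Convex ℝ R) (hf : HasNeighbours F L R f) (x : Φ) :
    NullMeasurableSet (ratioSet L R f x) m := by
  have htr : ∀ v : E, NullMeasurableSet {p | p + v ∈ R} m := fun v =>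
    (hc.nullMeasurableSet m).preimage (measurePreserving_add_right m v).quasiMeasurePreserving
  refine nullMeasurableSet_of_forall_mem_iff (ι := Option (F ⊕ F))
    (A := fun o => o.elim R (Sum.elim (fun μ => {p | p + f μ ∈ R}) fun μ => {p | p + (-f) μ ∈ R}))
    ?_ ?_
  · rintro (_ | μ | μ)
    exacts [hc.nullMeasurableSet m, htr _, htr _]
  · rintro p q h ⟨hp, hr⟩
    have hq := (h none).1 hp
    exact ⟨hq, hf.hasRatio_of_hasRatio hf hp hq (fun ν hν => h (some (Sum.inl ⟨ν, hν⟩)))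
      (fun ν hν => h (some (Sum.inr ⟨ν, hν⟩))) hr⟩

theorem sum_measureReal_ratioSet (hb : Bornology.IsBounded R) (hc : Convex ℝ R)
    (hf : HasNeighbours F L R f) {S : Finset Φ} (hS : quotients F ⊆ S) :
    ∑ x ∈ S, m.real (ratioSet L R f x) = m.real R := by
  have hU : R = ⋃ x ∈ S, ratioSet L R f x := by
    ext p
    simp only [Set.mem_iUnion, exists_prop]
    constructor
    · intro hp
      obtain ⟨x, hx, h⟩ := hf.exists_hasRatio hp
      exact ⟨x, hS hx, hp, h⟩
    · rintro ⟨x, -, hp, -⟩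
      exact hp
  have hfin : ∀ x ∈ S, m (ratioSet L R f x) ≠ ⊤ := fun x _ =>
    (hb.subset fun p hp => hp.1).measure_lt_top.ne
  conv_rhs => rw [hU]
  rw [measureReal_def, measure_biUnion_finset₀, ENNReal.toReal_sum hfin]
  · rfl
  · intro x _ x' _ hne
    refine Disjoint.aedisjoint (Set.disjoint_left.2 ?_)
    rintro p ⟨-, h⟩ ⟨-, h'⟩
    exact hne (h.unique h')
  · exact fun x _ => nullMeasurableSet_ratioSet m hc hf x

theorem isBounded_preimage_of_norm_sub_le {E : Type*} [SeminormedAddCommGroup E] {φ : E → E}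
    {δ : ℝ} (hφ : ∀ p, ‖φ p - p‖ ≤ δ) {A : Set E} (hA : Bornology.IsBounded A) :
    Bornology.IsBounded {p | φ p ∈ A} :=
  (hA.cthickening (δ := δ)).subset fun p hp =>
    Metric.mem_cthickening_of_dist_le p (φ p) δ A hp (by rw [dist_comm, dist_eq_norm]; exact hφ p)

/-- Moving the points and the displacements by at most `δ` changes the measures of the sets
`ratioSet` by `O(δ)`. -/
theorem exists_abs_measureReal_ratioSet_sub_le (F : Finset Φ) (hb : Bornology.IsBounded R)
    (hc : Convex ℝ R) (hi : (interior R).Nonempty) :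
    ∃ K : ℝ, 0 ≤ K ∧ ∀ δ : ℝ, 0 ≤ δ → δ ≤ 1 → ∀ φ : E → E, (∀ p, ‖φ p - p‖ ≤ δ) →
      |m.real {p | φ p ∈ R} - m.real R| ≤ K * δ ∧
      ∀ (L : AddSubgroup Φ) (f g : Φ → E), HasNeighbours F L R f → HasNeighbours F L R g →
        (∀ μ ∈ F, ‖f μ - g μ‖ ≤ δ) → ∀ x,
        |m.real {p | φ p ∈ ratioSet L R f x} - m.real (ratioSet L R g x)| ≤ K * δ := by
  obtain ⟨K, hK0, hK⟩ := measureReal_nearBoundary_le m hb hc hi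
  -- One boundary neighbourhood for `R` and one for each forward and backward translate, all of
  -- radius `2 * δ`; this is why the volume bound is used up to radius `2`.
  refine ⟨(1 + F.card + F.card) * (K * 2), by positivity, fun δ hδ0 hδ1 φ hφ => ⟨?_, ?_⟩⟩
  · have h0 := abs_measureReal_sub_le (m := m) (A := {p | φ p ∈ R}) (B := R)
      (N := nearBoundary R δ) (isBounded_preimage_of_norm_sub_le hφ hb).measure_lt_top.ne
      hb.measure_lt_top.ne (isBounded_nearBoundary hb δ).measure_lt_top.ne (fun p hp => by
        have hd : dist (φ p) p ≤ δ := by rw [dist_eq_norm]; exact hφ p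
        by_cases h : p ∈ R
        · exact ⟨p, h, φ p, fun h' => hp ⟨fun _ => h, fun _ => h'⟩, by simpa using hδ0, hd⟩
        · exact ⟨φ p, by_contra fun h' => hp ⟨fun a => absurd a h', fun a => absurd a h⟩, p, h, hd,
            by simpa using hδ0⟩)
    refine h0.trans ((hK δ hδ0 (by linarith)).trans ?_)
    have h1 : (0 : ℝ) ≤ F.card := Nat.cast_nonneg _
    have h2 : 0 ≤ K * δ := by positivity
    nlinarith [mul_nonneg h1 h2]
  · intro L f g hf hg hfg x
    set B := nearBoundary R (2 * δ)
    have hB : Bornology.IsBounded B := isBounded_nearBoundary hb _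
    have hBt : ∀ v : E, m {p | p + v ∈ B} ≠ ⊤ := fun v => by
      have : m {p | p + v ∈ B} = m B := measure_preimage_add_right m v B
      rw [this]
      exact hB.measure_lt_top.ne
    have hBK : m.real B ≤ K * 2 * δ := by
      have := hK (2 * δ) (by linarith) (by linarith)
      linarith
    set N : Set E := B ∪ ((⋃ μ ∈ F, {p | p + g μ ∈ B}) ∪ ⋃ μ ∈ F, {p | p + -g μ ∈ B})
    have hU : ∀ k : Φ → E, m (⋃ μ ∈ F, {p | p + k μ ∈ B}) ≠ ⊤ := fun k =>
      ((measure_biUnion_lt_top F.finite_toSet fun μ _ => (hBt _).lt_top)).ne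
    have hUr : ∀ k : Φ → E, m.real (⋃ μ ∈ F, {p | p + k μ ∈ B}) ≤ F.card * (K * 2 * δ) := by
      intro k
      refine (measureReal_biUnion_finset_le F _).trans ?_
      rw [← nsmul_eq_mul]
      refine Finset.sum_le_card_nsmul _ _ _ fun μ _ => ?_
      rw [measureReal_preimage_add]
      exact hBK
    have hN : m N ≠ ⊤ := measure_union_ne_top hB.measure_lt_top.ne
      (measure_union_ne_top (hU g) (hU fun μ => -g μ))
    have hRb : ∀ k : Φ → E, Bornology.IsBounded (ratioSet L R k x) := fun k =>
      hb.subset fun p hp => hp.1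
    have h0 := abs_measureReal_sub_le (m := m) (A := {p | φ p ∈ ratioSet L R f x})
      (B := ratioSet L R g x) (N := N)
      (isBounded_preimage_of_norm_sub_le hφ (hRb f)).measure_lt_top.ne
      (hRb g).measure_lt_top.ne hN (fun p hp => by
        simpa [N, B] using ratioSet_diff_subset hf hg hfg hφ hδ0 hp)
    refine h0.trans ?_
    have h1 := measureReal_union_le (μ := m) B
      ((⋃ μ ∈ F, {p | p + g μ ∈ B}) ∪ ⋃ μ ∈ F, {p | p + -g μ ∈ B})
    have h2 := measureReal_union_le (μ := m) (⋃ μ ∈ F, {p | p + g μ ∈ B})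
      (⋃ μ ∈ F, {p | p + -g μ ∈ B})
    have h3 := hUr g
    have h4 := hUr fun μ => -g μ
    calc m.real N ≤ K * 2 * δ + (F.card * (K * 2 * δ) + F.card * (K * 2 * δ)) := by linarith
      _ = _ := by ring

end Volume

end Spacings

end

noncomputable section

namespace Spacings

open NumberField ComplexConjugate

/-! ### Displacements as weighted sums over the complex embeddings. -/

section Displacement

variable {d : ℕ} {Φ : IntermediateField ℚ ℝ}

/-- The inclusion of `Φ` into `ℂ`. -/
def incl (Φ : IntermediateField ℚ ℝ) : Φ →+* ℂ := Complex.ofRealHom.comp (algebraMap Φ ℝ)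

theorem incl_apply (a : Φ) : incl Φ a = ((a : ℝ) : ℂ) := rfl

theorem norm_incl (a : Φ) : ‖incl Φ a‖ = |(a : ℝ)| := by
  rw [incl_apply, Complex.norm_real, Real.norm_eq_abs]

theorem conjugate_eq_incl_iff (σ : Φ →+* ℂ) :
    ComplexEmbedding.conjugate σ = incl Φ ↔ σ = incl Φ := by
  have h1 : ComplexEmbedding.conjugate (incl Φ) = incl Φ := by
    ext a
    simp [incl_apply]
  exact ⟨fun h => by rw [← ComplexEmbedding.involutive_conjugate Φ σ, h, h1],
    fun h => by rw [h, h1]⟩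

/-- Scales compatible with complex conjugation, of size between `c` and `C` at the embeddings
other than the inclusion, and at most `e` there. -/
structure IsScale (c C e : ℝ) (z : (Φ →+* ℂ) → ℂ) : Prop where
  conj_eq : ∀ σ, z (ComplexEmbedding.conjugate σ) = conj (z σ)
  le_norm : ∀ σ, σ ≠ incl Φ → c ≤ ‖z σ‖
  norm_le : ∀ σ, σ ≠ incl Φ → ‖z σ‖ ≤ C
  norm_incl_le : ‖z (incl Φ)‖ ≤ e

theorem IsScale.neg {c C e : ℝ} {z : (Φ →+* ℂ) → ℂ} (h : IsScale c C e z) : IsScale c C e (-z) where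
  conj_eq σ := by simp [h.conj_eq]
  le_norm σ hσ := by simpa using h.le_norm σ hσ
  norm_le σ hσ := by simpa using h.norm_le σ hσ
  norm_incl_le := by simpa using h.norm_incl_le

variable (b : Module.Basis (Fin (d + 1)) ℚ Φ)

/-- The `ℤ`-span of the basis `b`. -/
def basisLattice : AddSubgroup Φ := (Submodule.span ℤ (Set.range b)).toAddSubgroup

theorem mem_basisLattice {a : Φ} : a ∈ basisLattice b ↔ ∀ j, ∃ n : ℤ, (n : ℚ) = b.repr a j := by
  rw [basisLattice, Submodule.mem_toAddSubgroup, Module.Basis.mem_span_iff_repr_mem ℤ b]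
  rfl

theorem sum_intCast_mul_mem_basisLattice (n : Fin (d + 1) → ℤ) :
    ∑ j, (n j : Φ) * b j ∈ basisLattice b := by
  refine AddSubgroup.sum_mem _ fun j _ => ?_
  rw [← zsmul_eq_mul]
  exact AddSubgroup.zsmul_mem _ (Submodule.subset_span (Set.mem_range_self j) :
    b j ∈ Submodule.span ℤ (Set.range b)) _

variable [NumberField Φ]

/-- Conjugation permutes the embeddings, so it fixes the sum. -/
theorem sum_conj_symm (f : (Φ →+* ℂ) → ℂ)
    (hf : ∀ σ, f (ComplexEmbedding.conjugate σ) = conj (f σ)) :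
    ((∑ σ, f σ).re : ℂ) = ∑ σ, f σ := by
  apply Complex.conj_eq_iff_re.1
  rw [map_sum]
  simp_rw [← hf]
  exact Equiv.sum_comp (Function.Involutive.toPerm _ (ComplexEmbedding.involutive_conjugate Φ)) f

/-- The displacement of the window attached to `a : Φ`, at the scale `z`. For `z = 1` this is the
vector of coordinates of `a` with respect to `b`, the coordinate of index `0` omitted. -/
def disp (z : (Φ →+* ℂ) → ℂ) (a : Φ) : Fin d → ℝ :=
  fun i => (∑ σ, z σ * σ (b.traceDual i.succ) * σ a).re

/-- A coordinate is the trace of `a` against the dual basis vector, and the trace is the sum over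
the embeddings. -/
theorem repr_eq_sum (a : Φ) (j : Fin (d + 1)) :
    ((b.repr a j : ℚ) : ℂ) = ∑ σ : Φ →+* ℂ, σ (b.traceDual j) * σ a := by
  have h1 : b.repr a j = Algebra.trace ℚ Φ (a * b.traceDual j) := by
    conv_lhs => rw [← b.traceDual_traceDual]
    rw [Module.Basis.traceDual_repr_apply]
    rfl
  have h2 := trace_eq_sum_embeddings (K := ℚ) (L := Φ) ℂ (x := a * b.traceDual j)
  rw [h1]
  refine h2.trans ?_
  rw [← (RingHom.equivRatAlgHom (R := Φ) (S := ℂ)).sum_comp]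
  refine Finset.sum_congr rfl fun σ _ => ?_
  rw [map_mul, mul_comm]
  rfl

theorem disp_one (a : Φ) (i : Fin d) :
    disp b (fun _ => 1) a i = ((b.repr a i.succ : ℚ) : ℝ) := by
  simp only [disp, one_mul]
  rw [← repr_eq_sum]
  simp

theorem disp_mul (z : (Φ →+* ℂ) → ℂ) (u a : Φ) :
    disp b z (u * a) = disp b (fun σ => z σ * σ u) a := by
  ext i
  simp only [disp, map_mul]
  congr 1
  exact Finset.sum_congr rfl fun σ _ => by ring

theorem disp_neg (z : (Φ →+* ℂ) → ℂ) : disp b (-z) = -disp b z := by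
  ext a i
  simp [disp, Finset.sum_neg_distrib]

theorem card_embeddings_eq (b : Module.Basis (Fin (d + 1)) ℚ Φ) :
    Fintype.card (Φ →+* ℂ) = d + 1 := by
  rw [Embeddings.card, Module.finrank_eq_card_basis b, Fintype.card_fin]

/-- The matrices of conjugates of the dual basis and of the basis are square, since there are `d +
1` embeddings; hence the one-sided inverse given by `repr_eq_sum` is two-sided. -/
theorem sum_traceDual_mul [DecidableEq (Φ →+* ℂ)] (σ τ : Φ →+* ℂ) :
    ∑ j, σ (b j) * τ (b.traceDual j) = if σ = τ then 1 else 0 := by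
  let P : Matrix (Fin (d + 1)) (Φ →+* ℂ) ℂ := fun j σ => σ (b.traceDual j)
  let Q : Matrix (Φ →+* ℂ) (Fin (d + 1)) ℂ := fun σ j => σ (b j)
  have hPQ : P * Q = 1 := by
    ext i j
    rw [Matrix.mul_apply]
    refine (repr_eq_sum b (b j) i).symm.trans ?_
    rw [Module.Basis.repr_self, Finsupp.single_apply, Matrix.one_apply]
    by_cases h : i = j
    · simp [h]
    · simp [h, Ne.symm h]
  have e : Fin (d + 1) ≃ (Φ →+* ℂ) :=
    Fintype.equivOfCardEq (by rw [card_embeddings_eq b, Fintype.card_fin])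
  have hQP := (Matrix.mul_eq_one_comm_of_equiv e).1 hPQ
  have := congr_fun (congr_fun hQP σ) τ
  rwa [Matrix.mul_apply, Matrix.one_apply] at this

theorem sum_traceDual_mul_sum (y : Fin (d + 1) → ℂ) (k : Fin (d + 1)) :
    ∑ σ : Φ →+* ℂ, σ (b.traceDual k) * ∑ j, y j * σ (b j) = y k := by
  have h : ∀ j, ∑ σ : Φ →+* ℂ, σ (b.traceDual k) * σ (b j) = if j = k then 1 else 0 := by
    intro j
    rw [← repr_eq_sum, Module.Basis.repr_self, Finsupp.single_apply]
    split_ifs <;> simp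
  simp_rw [Finset.mul_sum]
  rw [Finset.sum_comm]
  calc _ = ∑ j, y j * ∑ σ : Φ →+* ℂ, σ (b.traceDual k) * σ (b j) := by
        refine Finset.sum_congr rfl fun j _ => ?_
        rw [Finset.mul_sum]
        exact Finset.sum_congr rfl fun σ _ => by ring
    _ = y k := by simp [h]

theorem sum_sum_traceDual_mul (Y : (Φ →+* ℂ) → ℂ) (σ : Φ →+* ℂ) :
    ∑ j, (∑ τ : Φ →+* ℂ, τ (b.traceDual j) * Y τ) * σ (b j) = Y σ := by
  classical
  simp_rw [Finset.sum_mul]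
  rw [Finset.sum_comm]
  calc _ = ∑ τ : Φ →+* ℂ, Y τ * ∑ j, σ (b j) * τ (b.traceDual j) := by
        refine Finset.sum_congr rfl fun τ _ => ?_
        rw [Finset.mul_sum]
        exact Finset.sum_congr rfl fun j _ => by ring
    _ = Y σ := by simp [sum_traceDual_mul]

/-- The sum of the absolute values of all the conjugates of the `b j`. -/
def basisSize : ℝ := ∑ σ : Φ →+* ℂ, ∑ j, ‖σ (b j)‖

/-- The sum of the absolute values of all the conjugates of the dual basis. -/
def dualSize : ℝ := ∑ j, ∑ σ : Φ →+* ℂ, ‖σ (b.traceDual j)‖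

theorem basisSize_nonneg : 0 ≤ basisSize b :=
  Finset.sum_nonneg fun _ _ => Finset.sum_nonneg fun _ _ => norm_nonneg _

theorem dualSize_nonneg : 0 ≤ dualSize b :=
  Finset.sum_nonneg fun _ _ => Finset.sum_nonneg fun _ _ => norm_nonneg _

theorem norm_sum_mul_basis_le (y : Fin (d + 1) → ℂ) {B : ℝ} (hy : ∀ j, ‖y j‖ ≤ B) (hB : 0 ≤ B)
    (σ : Φ →+* ℂ) : ‖∑ j, y j * σ (b j)‖ ≤ B * basisSize b := by
  calc ‖∑ j, y j * σ (b j)‖ ≤ ∑ j, B * ‖σ (b j)‖ := norm_sum_le_of_le _ fun j _ => by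
        rw [norm_mul]
        exact mul_le_mul_of_nonneg_right (hy j) (norm_nonneg _)
    _ = B * ∑ j, ‖σ (b j)‖ := by rw [Finset.mul_sum]
    _ ≤ _ := mul_le_mul_of_nonneg_left
        (Finset.single_le_sum (f := fun σ : Φ →+* ℂ => ∑ j, ‖σ (b j)‖)
          (fun _ _ => Finset.sum_nonneg fun _ _ => norm_nonneg _) (Finset.mem_univ σ)) hB

theorem norm_sum_traceDual_mul_le (Y : (Φ →+* ℂ) → ℂ) {B : ℝ} (hY : ∀ σ, ‖Y σ‖ ≤ B) (hB : 0 ≤ B)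
    (j : Fin (d + 1)) : ‖∑ σ : Φ →+* ℂ, σ (b.traceDual j) * Y σ‖ ≤ B * dualSize b := by
  calc ‖∑ σ : Φ →+* ℂ, σ (b.traceDual j) * Y σ‖ ≤ ∑ σ : Φ →+* ℂ, B * ‖σ (b.traceDual j)‖ :=
        norm_sum_le_of_le _ fun σ _ => by
          rw [norm_mul, mul_comm]
          exact mul_le_mul_of_nonneg_right (hY σ) (norm_nonneg _)
    _ = B * ∑ σ : Φ →+* ℂ, ‖σ (b.traceDual j)‖ := by rw [Finset.mul_sum]
    _ ≤ _ := mul_le_mul_of_nonneg_left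
        (Finset.single_le_sum (f := fun j => ∑ σ : Φ →+* ℂ, ‖σ (b.traceDual j)‖)
          (fun _ _ => Finset.sum_nonneg fun _ _ => norm_nonneg _) (Finset.mem_univ j)) hB

theorem finite_basisLattice_norm_le (B : ℝ) :
    {a : Φ | a ∈ basisLattice b ∧ ∀ σ : Φ →+* ℂ, ‖σ a‖ ≤ B}.Finite := by
  set N : ℝ := |B| * dualSize b
  refine ((Set.finite_Icc (fun _ : Fin (d + 1) => -⌈N⌉) (fun _ => ⌈N⌉)).image
    fun n => ∑ j, (n j : Φ) * b j).subset ?_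
  rintro a ⟨ha, hB⟩
  choose n hn using (mem_basisLattice b).1 ha
  have hle : ∀ j, |(n j : ℝ)| ≤ N := by
    intro j
    have h1 := norm_sum_traceDual_mul_le b (fun σ => σ a)
      (fun σ => (hB σ).trans (le_abs_self B)) (abs_nonneg B) j
    rw [← repr_eq_sum, ← hn] at h1
    simpa using h1
  refine ⟨n, ⟨fun j => ?_, fun j => ?_⟩, ?_⟩
  · have h1 := (abs_le.1 (hle j)).1
    have h2 := Int.le_ceil N
    have h3 : (-(⌈N⌉ : ℝ)) ≤ n j := by linarith
    exact_mod_cast h3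
  · have h1 := (abs_le.1 (hle j)).2
    have h2 := Int.le_ceil N
    have h3 : (n j : ℝ) ≤ ⌈N⌉ := by linarith
    exact_mod_cast h3
  · conv_rhs => rw [← b.sum_repr a]
    refine Finset.sum_congr rfl fun j _ => ?_
    rw [← hn, Algebra.smul_def]
    simp

theorem IsScale.disp_eq {c C e : ℝ} {z : (Φ →+* ℂ) → ℂ} (h : IsScale c C e z) (a : Φ) (i : Fin d) :
    ((disp b z a i : ℝ) : ℂ) = ∑ σ, z σ * σ (b.traceDual i.succ) * σ a := by
  refine sum_conj_symm _ fun σ => ?_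
  simp only [map_mul, h.conj_eq, ComplexEmbedding.conjugate_coe_eq]

/-- The displacement gives all coordinates of the weighted conjugate vector `(z τ * τ a)` except
that of index `0`. The component at the inclusion, of size at most `e * X`, supplies the missing one
because `b 0 = 1`; dividing by `‖z σ‖ ≥ c` then bounds `σ a`. Together with
`finite_basisLattice_norm_le` this makes the candidates for a neighbour finite in number. -/
theorem IsScale.norm_embedding_le {c C e : ℝ} {z : (Φ →+* ℂ) → ℂ} (hz : IsScale c C e z)
    (h0 : ((b 0 : Φ) : ℝ) = 1) (hc : 0 < c) (he0 : 0 ≤ e) {X B : ℝ} (hB : 0 ≤ B)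
    {a : Φ} (ha0 : 0 < (a : ℝ)) (haX : (a : ℝ) ≤ X) (ha : ‖disp b z a‖ ≤ B) (σ : Φ →+* ℂ) :
    ‖σ a‖ ≤ (e * X + B * basisSize b + B) * basisSize b / c + X := by
  have hX : 0 ≤ X := ha0.le.trans haX
  have hA := basisSize_nonneg b
  by_cases hσ : σ = incl Φ
  · rw [hσ, norm_incl, abs_of_pos ha0]
    have : 0 ≤ (e * X + B * basisSize b + B) * basisSize b / c := by positivity
    linarith
  set y : Fin (d + 1) → ℂ := fun j => ∑ τ : Φ →+* ℂ, τ (b.traceDual j) * (z τ * τ a) with hy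
  have hY : ∀ τ : Φ →+* ℂ, ∑ j, y j * τ (b j) = z τ * τ a :=
    sum_sum_traceDual_mul b fun τ => z τ * τ a
  have hys : ∀ i : Fin d, ‖y i.succ‖ ≤ B := by
    intro i
    have h1 : y i.succ = ((disp b z a i : ℝ) : ℂ) := by
      rw [hz.disp_eq, hy]
      exact Finset.sum_congr rfl fun τ _ => by ring
    rw [h1, Complex.norm_real]
    exact (norm_le_pi_norm _ i).trans ha
  have hy0 : ‖y 0‖ ≤ e * X + B * basisSize b := by
    have h1 := hY (incl Φ)
    rw [Fin.sum_univ_succ, incl_apply (b 0), h0, Complex.ofReal_one, mul_one] at h1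
    have h2 := norm_sum_mul_basis_le b (Fin.cons 0 fun i => y i.succ) (B := B)
      (fun j => by refine Fin.cases ?_ (fun i => ?_) j <;> simp [hB, hys]) hB (incl Φ)
    rw [Fin.sum_univ_succ] at h2
    simp only [Fin.cons_zero, zero_mul, zero_add, Fin.cons_succ] at h2
    rw [eq_sub_of_add_eq h1]
    refine (norm_sub_le _ _).trans (add_le_add ?_ h2)
    rw [norm_mul, norm_incl, abs_of_pos ha0]
    exact mul_le_mul hz.norm_incl_le haX ha0.le he0
  have h1 := norm_sum_mul_basis_le b y (B := e * X + B * basisSize b + B) (fun j => by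
    refine Fin.cases ?_ (fun i => ?_) j
    · linarith
    · have : 0 ≤ e * X + B * basisSize b := by positivity
      linarith [hys i]) (by positivity) σ
  rw [hY, norm_mul] at h1
  have h2 : ‖σ a‖ ≤ (e * X + B * basisSize b + B) * basisSize b / c := by
    rw [le_div_iff₀ hc]
    nlinarith [hz.le_norm σ hσ, norm_nonneg (σ a)]
  linarith

end Displacement

end Spacings

end

noncomputable section

namespace Spacings

open NumberField ComplexConjugate

/-! ### Uniform finiteness of the neighbours. -/

section Approximation

variable {d : ℕ} {Φ : IntermediateField ℚ ℝ} [NumberField Φ] (b : Module.Basis (Fin (d + 1)) ℚ Φ)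

/-- For every conjugation invariant vector, some lattice element has nearly these conjugates. -/
theorem exists_mem_basisLattice_norm_sub_le (W : (Φ →+* ℂ) → ℂ)
    (hW : ∀ σ, W (ComplexEmbedding.conjugate σ) = conj (W σ)) :
    ∃ μ ∈ basisLattice b, ∀ σ, ‖σ μ - W σ‖ ≤ basisSize b := by
  set n : Fin (d + 1) → ℝ := fun j => (∑ σ : Φ →+* ℂ, σ (b.traceDual j) * W σ).re with hn
  have hnc : ∀ j, ((n j : ℝ) : ℂ) = ∑ σ : Φ →+* ℂ, σ (b.traceDual j) * W σ := fun j =>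
    sum_conj_symm _ fun σ => by simp only [map_mul, hW, ComplexEmbedding.conjugate_coe_eq]
  refine ⟨∑ j, ((⌊n j⌋ : ℤ) : Φ) * b j, sum_intCast_mul_mem_basisLattice b _, fun σ => ?_⟩
  have h1 : W σ = ∑ j, ((n j : ℝ) : ℂ) * σ (b j) := by
    simp_rw [hnc]
    exact (sum_sum_traceDual_mul b W σ).symm
  have h2 : σ (∑ j, ((⌊n j⌋ : ℤ) : Φ) * b j) - W σ =
      ∑ j, ((-Int.fract (n j) : ℝ) : ℂ) * σ (b j) := by
    rw [h1, map_sum, ← Finset.sum_sub_distrib]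
    refine Finset.sum_congr rfl fun j _ => ?_
    rw [map_mul, map_intCast, ← sub_mul, ← Int.self_sub_floor]
    push_cast
    ring
  rw [h2, ← one_mul (basisSize b)]
  refine norm_sum_mul_basis_le b _ (fun j => ?_) zero_le_one σ
  rw [Complex.norm_real, Real.norm_eq_abs, abs_neg, abs_of_nonneg (Int.fract_nonneg _)]
  exact (Int.fract_lt_one _).le

/-- Any target can be reached approximately: a lattice element is found up to a fixed error in each
conjugate, and multiplication by the contracting `u` shrinks that error by `κ` at all embeddings but
the inclusion, where the small weight `e` takes over. -/
theorem exists_norm_disp_sub_le (h0 : ((b 0 : Φ) : ℝ) = 1) {c C e κ : ℝ} (hc : 0 < c)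
    (hC : 0 ≤ C) (he : 0 ≤ e) (hκ : 0 ≤ κ) {u : Φ} (hu0 : 0 < (u : ℝ))
    (hu : ∀ a, u * a ∈ basisLattice b ↔ a ∈ basisLattice b)
    (huκ : ∀ σ : Φ →+* ℂ, σ ≠ incl Φ → ‖σ u‖ ≤ κ) {z : (Φ →+* ℂ) → ℂ} (hz : IsScale c C e z)
    (y : Fin d → ℝ) :
    ∃ μ ∈ basisLattice b, 0 < (μ : ℝ) ∧ (μ : ℝ) ≤ u * (2 * basisSize b + 1) ∧
      ‖disp b z μ - y‖ ≤
        (C * κ * basisSize b + e * (u * (2 * basisSize b + 1))) * dualSize b := by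
  classical
  set A := basisSize b
  have hA : 0 ≤ A := basisSize_nonneg b
  have hune : u ≠ 0 := by rintro rfl; exact lt_irrefl _ hu0
  -- The free coordinate of index `0` is chosen to make the component at the inclusion vanish.
  set y' : Fin (d + 1) → ℝ := Fin.cons (-∑ i, y i * (b i.succ : ℝ)) y with hy'
  set Y : (Φ →+* ℂ) → ℂ := fun σ => ∑ j, ((y' j : ℝ) : ℂ) * σ (b j) with hY
  have hYincl : Y (incl Φ) = 0 := by
    simp only [hY, incl_apply]
    rw [Fin.sum_univ_succ, h0]
    simp only [hy', Fin.cons_zero, Fin.cons_succ]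
    push_cast
    ring
  have hYconj : ∀ σ, Y (ComplexEmbedding.conjugate σ) = conj (Y σ) := fun σ => by
    simp only [hY, map_sum, map_mul, Complex.conj_ofReal, ComplexEmbedding.conjugate_coe_eq]
  -- With approximation error `A`, the target `A + 1` at the inclusion yields `1 ≤ μ ≤ 2 * A + 1`,
  -- in particular positivity.
  obtain ⟨μ, hμL, hμ⟩ := exists_mem_basisLattice_norm_sub_le b
    (fun σ => if σ = incl Φ then ((A + 1 : ℝ) : ℂ) else Y σ / (z σ * σ u)) (fun σ => by
      simp only [conjugate_eq_incl_iff]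
      split_ifs
      · rw [Complex.conj_ofReal]
      · rw [hYconj, hz.conj_eq, map_div₀, map_mul, ComplexEmbedding.conjugate_coe_eq])
  have hμincl := hμ (incl Φ)
  rw [if_pos rfl, incl_apply, ← Complex.ofReal_sub, Complex.norm_real, Real.norm_eq_abs,
    abs_le] at hμincl
  have hμ0 : 0 < (μ : ℝ) := by linarith [hμincl.1]
  have hμX : (u : ℝ) * μ ≤ u * (2 * A + 1) :=
    mul_le_mul_of_nonneg_left (by linarith [hμincl.2]) hu0.le
  have hX : 0 ≤ (u : ℝ) * (2 * A + 1) := by positivity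
  refine ⟨u * μ, (hu μ).2 hμL, by push_cast; positivity, by push_cast; exact hμX, ?_⟩
  have hbd : 0 ≤ (C * κ * A + e * (u * (2 * A + 1))) * dualSize b := by
    have := dualSize_nonneg b
    positivity
  refine (pi_norm_le_iff_of_nonneg hbd).2 fun i => ?_
  have e1 : ((y i : ℝ) : ℂ) = ∑ σ : Φ →+* ℂ, σ (b.traceDual i.succ) * Y σ := by
    simp only [hY]
    rw [sum_traceDual_mul_sum b (fun j => ((y' j : ℝ) : ℂ)) i.succ, hy', Fin.cons_succ]
  have e2 : ((disp b z (u * μ) i - y i : ℝ) : ℂ) =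
      ∑ σ : Φ →+* ℂ, σ (b.traceDual i.succ) * (z σ * σ (u * μ) - Y σ) := by
    rw [Complex.ofReal_sub, hz.disp_eq, e1, ← Finset.sum_sub_distrib]
    exact Finset.sum_congr rfl fun σ _ => by ring
  rw [Pi.sub_apply, ← Complex.norm_real, e2]
  refine norm_sum_traceDual_mul_le b (fun σ => z σ * σ (u * μ) - Y σ) (fun σ => ?_)
    (by positivity) _
  by_cases hσ : σ = incl Φ
  · have h1 : ‖z σ * σ (u * μ)‖ ≤ e * (u * (2 * A + 1)) := by
      rw [hσ, norm_mul, norm_incl]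
      refine mul_le_mul hz.norm_incl_le ?_ (abs_nonneg _) he
      push_cast
      rwa [abs_of_pos (mul_pos hu0 hμ0)]
    simp only [hσ, hYincl, sub_zero] at h1 ⊢
    have : 0 ≤ C * κ * A := by positivity
    linarith
  · have h1 := hμ σ
    rw [if_neg hσ] at h1
    have hz0 : z σ ≠ 0 := norm_pos_iff.1 (hc.trans_le (hz.le_norm σ hσ))
    have hσu : σ u ≠ 0 := by simpa using hune
    have h2 : z σ * σ (u * μ) - Y σ = z σ * σ u * (σ μ - Y σ / (z σ * σ u)) := by
      rw [map_mul]
      field_simp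
    rw [h2, norm_mul, norm_mul]
    have h3 : ‖z σ‖ * ‖σ u‖ * ‖σ μ - Y σ / (z σ * σ u)‖ ≤ C * κ * A :=
      mul_le_mul (mul_le_mul (hz.norm_le σ hσ) (huκ σ hσ) (norm_nonneg _) hC) h1
        (norm_nonneg _) (by positivity)
    have : 0 ≤ e * (u * (2 * A + 1)) := by positivity
    linarith

/-- If there are arbitrarily contracting multipliers of the lattice, then for all scales in a
compact set the neighbours lie in one finite set. -/
theorem exists_hasNeighbours_disp (h0 : ((b 0 : Φ) : ℝ) = 1)
    (hcontr : ∀ κ : ℝ, 0 < κ → ∃ u : Φ, 0 < (u : ℝ) ∧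
      (∀ a, u * a ∈ basisLattice b ↔ a ∈ basisLattice b) ∧
      ∀ σ : Φ →+* ℂ, σ ≠ incl Φ → ‖σ u‖ ≤ κ)
    {R : Set (Fin d → ℝ)} (hb : Bornology.IsBounded R) (hi : (interior R).Nonempty)
    {c C : ℝ} (hc : 0 < c) (hC : 0 ≤ C) :
    ∃ e : ℝ, 0 < e ∧ ∃ F : Finset Φ, ∀ z, IsScale c C e z →
      HasNeighbours F (basisLattice b) R (disp b z) := by
  obtain ⟨q, hq⟩ := hi
  obtain ⟨ρ, hρ, hball⟩ := Metric.isOpen_iff.1 isOpen_interior q hq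
  obtain ⟨B, hB⟩ := hb.exists_norm_le
  have hB0 : 0 ≤ B := (norm_nonneg q).trans (hB q (interior_subset hq))
  set A := basisSize b
  set D := dualSize b
  have hA : 0 ≤ A := basisSize_nonneg b
  have hD : 0 ≤ D := dualSize_nonneg b
  -- This `κ`, and below `e`, each make one error term at most `ρ / 3`. The order matters: `e`
  -- depends on `X`, hence on `u`.
  obtain ⟨u, hu0, hu, huκ⟩ := hcontr (ρ / (3 * (C * A * D + 1))) (by positivity)
  set κ := ρ / (3 * (C * A * D + 1)) with hκ
  set X : ℝ := u * (2 * A + 1) with hX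
  have hX0 : 0 < X := by positivity
  set e := ρ / (3 * (X * D + 1)) with he
  have he0 : 0 < e := by positivity
  have hκ0 : 0 < κ := by positivity
  have hsmall : (C * κ * A + e * X) * D < ρ := by
    have h1 : C * κ * A * D ≤ ρ / 3 := by
      have : C * κ * A * D = ρ / 3 * ((C * A * D) / (C * A * D + 1)) := by
        rw [hκ]; field_simp
      rw [this]
      exact mul_le_of_le_one_right (by positivity)
        ((div_le_one (by positivity)).2 (by linarith))
    have h2 : e * X * D ≤ ρ / 3 := by
      have : e * X * D = ρ / 3 * ((X * D) / (X * D + 1)) := by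
        rw [he]; field_simp
      rw [this]
      exact mul_le_of_le_one_right (by positivity)
        ((div_le_one (by positivity)).2 (by linarith))
    linarith
  set B' := (e * X + 2 * B * A + 2 * B) * A / c + X
  set F := (finite_basisLattice_norm_le b B').toFinset with hF
  have key : ∀ z, IsScale c C e z → ∀ p ∈ R, ∃ μ ∈ F, IsNext (basisLattice b) R (disp b z) p μ := by
    intro z hz p hp
    set T : Set Φ := {ν | ν ∈ basisLattice b ∧ 0 < (ν : ℝ) ∧ (ν : ℝ) ≤ X ∧ p + disp b z ν ∈ R}
    have hTF : T ⊆ F := by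
      rintro ν ⟨h1, h2, h3, h4⟩
      refine (Set.Finite.mem_toFinset _).2 ⟨h1, fun σ => ?_⟩
      refine hz.norm_embedding_le b h0 hc he0.le (B := 2 * B) (by positivity) h2 h3 ?_ σ
      have : disp b z ν = (p + disp b z ν) - p := by abel
      rw [this]
      refine (norm_sub_le _ _).trans ?_
      linarith [hB _ h4, hB _ hp]
    have hTne : T.Nonempty := by
      obtain ⟨ν, h1, h2, h3, h4⟩ :=
        exists_norm_disp_sub_le b h0 hc hC he0.le hκ0.le hu0 hu huκ hz (q - p)
      refine ⟨ν, h1, h2, h3, interior_subset (hball ?_)⟩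
      rw [Metric.mem_ball, dist_eq_norm]
      have : p + disp b z ν - q = disp b z ν - (q - p) := by abel
      rw [this]
      exact h4.trans_lt hsmall
    obtain ⟨μ, hμ, hmin⟩ := Set.exists_min_image T (fun ν : Φ => (ν : ℝ))
      (F.finite_toSet.subset hTF) hTne
    refine ⟨μ, hTF hμ, hμ.1, hμ.2.1, hμ.2.2.2, fun ν h1 h2 h3 => ?_⟩
    rcases le_total (ν : ℝ) X with h | h
    · exact hmin ν ⟨h1, h2, h, h3⟩
    · exact hμ.2.2.1.trans h
  refine ⟨e, he0, F, fun z hz p hp => ⟨key z hz p hp, ?_⟩⟩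
  -- The backward neighbours are the forward ones at the scale `-z`.
  rw [← disp_neg]
  exact key (-z) hz.neg p hp

/-- Displacements depend in a Lipschitz way on the scale. -/
theorem norm_disp_sub_disp_le {z w : (Φ →+* ℂ) → ℂ} {δ B : ℝ} (hδ : 0 ≤ δ) (hB : 0 ≤ B)
    (h : ∀ σ, ‖z σ - w σ‖ ≤ δ) {a : Φ} (ha : ∀ σ : Φ →+* ℂ, ‖σ a‖ ≤ B) :
    ‖disp b z a - disp b w a‖ ≤ δ * B * dualSize b := by
  have hD := dualSize_nonneg b
  refine (pi_norm_le_iff_of_nonneg (by positivity)).2 fun i => ?_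
  have e1 : (disp b z a - disp b w a) i =
      (∑ σ : Φ →+* ℂ, σ (b.traceDual i.succ) * ((z σ - w σ) * σ a)).re := by
    rw [Pi.sub_apply, disp, disp, ← Complex.sub_re, ← Finset.sum_sub_distrib]
    congr 1
    exact Finset.sum_congr rfl fun σ _ => by ring
  rw [e1]
  refine (Complex.abs_re_le_norm _).trans (norm_sum_traceDual_mul_le b _ (fun σ => ?_)
    (by positivity) _)
  rw [norm_mul]
  exact mul_le_mul (h σ) (ha σ) (norm_nonneg _) hδ

end Approximation

end Spacings

end

noncomputable section

namespace Spacings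

open NumberField ComplexConjugate NumberField.Units NumberField.Units.dirichletUnitTheorem

/-! ### Units that preserve the lattice. -/

section Units

variable {d : ℕ} {Φ : IntermediateField ℚ ℝ}

/-- The logarithms of fundamental units span all real vectors of trace zero. -/
theorem exists_sum_mul_log_fundSystem (K : Type*) [Field K] [NumberField K]
    (f : InfinitePlace K → ℝ) (hf : ∑ w, f w = 0) :
    ∃ β : Fin (rank K) → ℝ, ∀ w : InfinitePlace K,
      ∑ i, β i * (w.mult * Real.log (w (fundSystem K i : K))) = f w := by
  classical
  set B := basisOfIsMaxRank (isMaxRank_fundSystem K)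
  set v : logSpace K := fun w => f w.1
  set β := B.repr v
  have h1 : ∀ w : InfinitePlace K, w ≠ w₀ →
      ∑ i, β i * (w.mult * Real.log (w (fundSystem K i : K))) = f w := by
    intro w hw
    have h2 := congr_fun (B.sum_repr v) ⟨w, hw⟩
    rw [Finset.sum_apply] at h2
    rw [← show v ⟨w, hw⟩ = f w from rfl, ← h2]
    refine Finset.sum_congr rfl fun i _ => ?_
    rw [Pi.smul_apply, basisOfIsMaxRank_apply, logEmbedding_component, smul_eq_mul]
  refine ⟨β, fun w => ?_⟩
  by_cases hw : w = w₀
  -- At the place omitted from the log space, equality follows because both sides have total zero,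
  -- for units by the product formula.
  · subst hw
    have h2 : ∑ w : InfinitePlace K,
        ∑ i, β i * (w.mult * Real.log (w (fundSystem K i : K))) = 0 := by
      rw [Finset.sum_comm]
      refine Finset.sum_eq_zero fun i _ => ?_
      rw [← Finset.mul_sum]
      have := sum_mult_mul_log (fundSystem K i)
      rw [this, mul_zero]
    rw [← hf, Fintype.sum_eq_add_sum_subtype_ne _ w₀, Fintype.sum_eq_add_sum_subtype_ne f w₀,
      Finset.sum_congr rfl fun (w : {w : InfinitePlace K // w ≠ w₀}) _ => h1 w.1 w.2] at h2
    exact add_right_cancel h2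
  · exact h1 w hw

theorem mk_ne_mk_incl {σ : Φ →+* ℂ} (hσ : σ ≠ incl Φ) :
    InfinitePlace.mk σ ≠ InfinitePlace.mk (incl Φ) := by
  rw [Ne, InfinitePlace.mk_eq_iff, not_or]
  refine ⟨hσ, fun h => hσ ?_⟩
  rw [← ComplexEmbedding.involutive_conjugate Φ σ, h]
  ext a
  simp [incl_apply]

variable [NumberField Φ]

theorem exists_sum_mul_log_norm_fundSystem (Φ : IntermediateField ℚ ℝ) [NumberField Φ] :
    ∃ β : Fin (rank Φ) → ℝ, ∀ σ : Φ →+* ℂ, σ ≠ incl Φ →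
      ∑ i, β i * Real.log ‖σ (fundSystem Φ i : Φ)‖ = -1 := by
  classical
  set w₁ := InfinitePlace.mk (incl Φ)
  -- The value at `w₁` is the one forced by trace zero.
  set f : InfinitePlace Φ → ℝ := fun w =>
    if w = w₁ then ∑ w' : {w : InfinitePlace Φ // w ≠ w₁}, (w'.1.mult : ℝ) else -w.mult
  have hf : ∑ w, f w = 0 := by
    rw [Fintype.sum_eq_add_sum_subtype_ne _ w₁]
    have : ∀ w : {w : InfinitePlace Φ // w ≠ w₁}, f w.1 = -(w.1.mult : ℝ) := fun w =>
      if_neg w.2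
    simp only [this, Finset.sum_neg_distrib]
    simp [f]
  obtain ⟨β, hβ⟩ := exists_sum_mul_log_fundSystem Φ f hf
  refine ⟨β, fun σ hσ => ?_⟩
  have h1 := hβ (InfinitePlace.mk σ)
  have h2 : f (InfinitePlace.mk σ) = -((InfinitePlace.mk σ).mult : ℝ) :=
    if_neg (mk_ne_mk_incl hσ)
  have h3 : ((InfinitePlace.mk σ).mult : ℝ) ≠ 0 := InfinitePlace.mult_coe_ne_zero
  rw [h2] at h1
  have h4 : ((InfinitePlace.mk σ).mult : ℝ) * ∑ i, β i * Real.log ‖σ (fundSystem Φ i : Φ)‖ =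
      -((InfinitePlace.mk σ).mult : ℝ) := by
    rw [← h1, Finset.mul_sum]
    refine Finset.sum_congr rfl fun i _ => ?_
    rw [InfinitePlace.apply]
    ring
  exact mul_left_cancel₀ h3 (by rw [h4, mul_neg_one])

variable (b : Module.Basis (Fin (d + 1)) ℚ Φ)

/-- Up to a bounded denominator, the lattice is the ring of integers. -/
theorem exists_natCast_mul_mem : ∃ N : ℤ, N ≠ 0 ∧
    (∀ a ∈ basisLattice b, IsIntegral ℤ ((N : Φ) * a)) ∧
    ∀ a : Φ, IsIntegral ℤ a → (N : Φ) * a ∈ basisLattice b := by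
  classical
  -- Clearing the denominators of the basis makes `N * a` integral for `a` in the lattice; clearing
  -- those of the dual basis makes the coordinates of `N * a`, which are traces, integers for
  -- integral `a`.
  obtain ⟨N, hN0, hN⟩ := exists_integral_multiples ℤ ℚ
    (Finset.univ.image b ∪ Finset.univ.image b.traceDual)
  have hN1 : ∀ j, IsIntegral ℤ ((N : Φ) * b j) := fun j => by
    rw [← zsmul_eq_mul]
    exact hN _ (by simp)
  have hN2 : ∀ j, IsIntegral ℤ ((N : Φ) * b.traceDual j) := fun j => by
    rw [← zsmul_eq_mul]
    exact hN _ (by simp)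
  refine ⟨N, hN0, fun a ha => ?_, fun a ha => ?_⟩
  · choose n hn using (mem_basisLattice b).1 ha
    have : (N : Φ) * a = ∑ j, (n j : Φ) * ((N : Φ) * b j) := by
      conv_lhs => rw [← b.sum_repr a]
      rw [Finset.mul_sum]
      refine Finset.sum_congr rfl fun j _ => ?_
      rw [← hn, Algebra.smul_def, map_intCast]
      ring
    rw [this]
    exact IsIntegral.sum _ fun j _ => (isIntegral_algebraMap (x := n j)).mul (hN1 j)
  · refine (mem_basisLattice b).2 fun j => ?_
    have h1 : b.repr ((N : Φ) * a) j = Algebra.trace ℚ Φ (a * ((N : Φ) * b.traceDual j)) := by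
      conv_lhs => rw [← b.traceDual_traceDual]
      rw [Module.Basis.traceDual_repr_apply]
      rw [show a * ((N : Φ) * b.traceDual j) = (N : Φ) * a * b.traceDual j by ring]
      rfl
    rw [h1]
    have h2 : IsIntegral ℤ (Algebra.trace ℚ Φ (a * ((N : Φ) * b.traceDual j))) :=
      Algebra.isIntegral_trace (ha.mul (hN2 j))
    obtain ⟨n, hn⟩ := IsIntegrallyClosed.isIntegral_iff.1 h2
    exact ⟨n, hn⟩

/-- Some power of a unit preserves the lattice. -/
theorem exists_pow_mul_mem_iff (u : (𝓞 Φ)ˣ) : ∃ k : ℕ, 0 < k ∧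
    ∀ a, (u : Φ) ^ k * a ∈ basisLattice b ↔ a ∈ basisLattice b := by
  obtain ⟨N, hN0, h1, h2⟩ := exists_natCast_mul_mem b
  -- If `v ^ k = 1 + c * N ^ 2`, then `v ^ k * a = a + N * (c * (N * a))`, where one factor `N`
  -- makes `N * a` integral and the other brings the product back into the lattice.
  set I : Ideal (𝓞 Φ) := Ideal.span {((N * N : ℤ) : 𝓞 Φ)}
  have hI : I ≠ ⊥ := by
    rw [Ne, Ideal.span_singleton_eq_bot]
    exact_mod_cast mul_ne_zero hN0 hN0
  have : Finite (𝓞 Φ ⧸ I) := I.finiteQuotientOfFreeOfNeBot hI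
  refine ⟨Nat.card (𝓞 Φ ⧸ I)ˣ, Nat.card_pos, ?_⟩
  set k := Nat.card (𝓞 Φ ⧸ I)ˣ
  have key : ∀ v : (𝓞 Φ)ˣ, ∀ a ∈ basisLattice b, (v : Φ) ^ k * a ∈ basisLattice b := by
    intro v a ha
    have h3 : Units.map (Ideal.Quotient.mk I).toMonoidHom v ^ k = 1 := pow_card_eq_one'
    have h4 : Ideal.Quotient.mk I ((v : 𝓞 Φ) ^ k) = Ideal.Quotient.mk I 1 := by
      have := congrArg Units.val h3
      simpa using this
    obtain ⟨c, hc⟩ := Ideal.mem_span_singleton'.1 ((Ideal.Quotient.mk_eq_mk_iff_sub_mem _ _).1 h4)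
    have h5 := congrArg (algebraMap (𝓞 Φ) Φ) hc
    rw [map_mul, map_sub, map_one, map_pow, map_intCast, Int.cast_mul] at h5
    have h6 : (v : Φ) ^ k * a = a + (N : Φ) * (algebraMap (𝓞 Φ) Φ c * ((N : Φ) * a)) := by
      rw [sub_eq_iff_eq_add.1 h5.symm]
      ring
    rw [h6]
    exact AddSubgroup.add_mem _ ha (h2 _ (c.isIntegral_coe.mul (h1 a ha)))
  intro a
  refine ⟨fun h => ?_, key u a⟩
  have h3 := key u⁻¹ _ h
  rw [← mul_assoc, ← mul_pow, ← NumberField.Units.coe_mul, inv_mul_cancel,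
    NumberField.Units.coe_one, one_pow, one_mul] at h3
  exact h3

theorem prod_norm_embedding_unit (u : (𝓞 Φ)ˣ) : ∏ σ : Φ →+* ℂ, ‖σ (u : Φ)‖ = 1 := by
  have h1 := Algebra.norm_eq_prod_embeddings ℚ ℂ (u : Φ)
  have h2 := NumberField.Units.norm Φ u
  have h3 : ∏ σ : Φ →ₐ[ℚ] ℂ, σ (u : Φ) = ∏ σ : Φ →+* ℂ, σ (u : Φ) :=
    ((RingHom.equivRatAlgHom (R := Φ) (S := ℂ)).prod_comp fun σ => σ (u : Φ)).symm
  rw [← norm_prod, ← h3, ← h1, eq_ratCast, Complex.norm_ratCast, ← Rat.cast_abs, h2, Rat.cast_one]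

/-- Units preserving the lattice whose logarithms represent the direction `(1, …, 1)`. -/
theorem exists_units_mul_mem_iff : ∃ (η : Fin (rank Φ) → Φ) (β : Fin (rank Φ) → ℝ),
    (∀ i, η i ≠ 0) ∧ (∀ i a, η i * a ∈ basisLattice b ↔ a ∈ basisLattice b) ∧
    (∀ i, ∏ σ : Φ →+* ℂ, ‖σ (η i)‖ = 1) ∧
    ∀ σ : Φ →+* ℂ, σ ≠ incl Φ → ∑ i, β i * (2 * Real.log ‖σ (η i)‖) = -1 := by
  choose k hk0 hk using exists_pow_mul_mem_iff b
  obtain ⟨β, hβ⟩ := exists_sum_mul_log_norm_fundSystem Φ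
  refine ⟨fun i => (fundSystem Φ i : Φ) ^ k (fundSystem Φ i),
    -- The division by `k` compensates for the power, and by `2` for the squares taken in `unitAt`.
    fun i => β i / (2 * k (fundSystem Φ i)),
    fun i => pow_ne_zero _ (NumberField.Units.coe_ne_zero _),
    fun i => hk _, fun i => ?_, fun σ hσ => ?_⟩
  · simp only [map_pow, norm_pow, Finset.prod_pow, prod_norm_embedding_unit, one_pow]
  · rw [← hβ σ hσ]
    refine Finset.sum_congr rfl fun i _ => ?_
    have : (k (fundSystem Φ i) : ℝ) ≠ 0 := Nat.cast_ne_zero.2 (hk0 _).ne'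
    rw [map_pow, norm_pow, Real.log_pow]
    field_simp

end Units

end Spacings

end

noncomputable section

namespace Spacings

open NumberField ComplexConjugate

/-! ### The compact family of scales. -/

section Scales

theorem norm_exp_sub_exp_le {B : ℝ} {x y : ℂ} (hx : x.re ≤ B) (hy : y.re ≤ B) :
    ‖Complex.exp x - Complex.exp y‖ ≤ Real.exp B * ‖x - y‖ := by
  refine (convex_halfSpace_re_le B).norm_image_sub_le_of_norm_deriv_le (f := Complex.exp)
    (fun z _ => Complex.differentiableAt_exp) (fun z hz => ?_) hy hx
  rw [Complex.deriv_exp, Complex.norm_exp]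
  exact Real.exp_le_exp.2 hz

theorem norm_toCircle_sub_le (x y : UnitAddCircle) :
    ‖(AddCircle.toCircle x : ℂ) - AddCircle.toCircle y‖ ≤ 2 * Real.pi * ‖x - y‖ := by
  have h1 : ‖(AddCircle.toCircle x : ℂ) - AddCircle.toCircle y‖ =
      ‖(AddCircle.toCircle (x - y) : ℂ) - 1‖ := by
    have : (AddCircle.toCircle x : ℂ) =
        (AddCircle.toCircle (x - y) : ℂ) * AddCircle.toCircle y := by
      rw [← Circle.coe_mul, ← AddCircle.toCircle_add, sub_add_cancel]
    rw [this, ← sub_one_mul, norm_mul, Circle.norm_coe, mul_one]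
  rw [h1]
  generalize x - y = v
  induction v using QuotientAddGroup.induction_on with
  | H s =>
    have h2 : ((s : ℝ) : UnitAddCircle) = ((s - round s : ℝ) : UnitAddCircle) := by
      rw [AddCircle.coe_sub]
      have : ((round s : ℝ) : UnitAddCircle) = 0 := by
        rw [AddCircle.coe_eq_zero_iff]
        exact ⟨round s, by simp⟩
      rw [this, sub_zero]
    have h3 : ‖((s : ℝ) : UnitAddCircle)‖ = |s - round s| := UnitAddCircle.norm_eq
    change ‖((AddCircle.toCircle ((s : ℝ) : UnitAddCircle)) : ℂ) - 1‖ ≤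
      2 * Real.pi * ‖((s : ℝ) : UnitAddCircle)‖
    rw [h3, h2, AddCircle.toCircle_apply_mk, Circle.coe_exp]
    have h4 := Real.norm_exp_I_mul_ofReal_sub_one_le (x := 2 * Real.pi / 1 * (s - round s))
    rw [mul_comm Complex.I] at h4
    refine h4.trans (le_of_eq ?_)
    rw [Real.norm_eq_abs, abs_mul, div_one, abs_of_pos Real.two_pi_pos]

/-- The difference of arguments is used instead of `2 * arg x` because it is odd under conjugation
also on the negative real axis, where it vanishes. This makes `sqLog` compatible with conjugation.
-/
theorem sq_eq_exp {x : ℂ} (hx : x ≠ 0) :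
    x ^ 2 = Complex.exp (((2 * Real.log ‖x‖ : ℝ) : ℂ) +
      ((Complex.arg x - Complex.arg (conj x) : ℝ) : ℂ) * Complex.I) := by
  have h0 : ((Real.exp (Real.log ‖x‖) : ℝ) : ℂ) = ‖x‖ := by
    rw [Real.exp_log (norm_pos_iff.2 hx)]
  have h1 := Complex.norm_mul_exp_arg_mul_I x
  have h2 := Complex.norm_mul_exp_arg_mul_I (conj x)
  have h3 : x = ‖x‖ * Complex.exp (-(Complex.arg (conj x) : ℂ) * Complex.I) := by
    have := congrArg conj h2
    rw [map_mul, ← Complex.exp_conj, map_mul, Complex.conj_I, Complex.conj_conj,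
      Complex.conj_ofReal, Complex.conj_ofReal, Complex.norm_conj] at this
    rw [neg_mul_comm, this]
  calc x ^ 2 = (‖x‖ * Complex.exp (Complex.arg x * Complex.I)) *
        (‖x‖ * Complex.exp (-(Complex.arg (conj x) : ℂ) * Complex.I)) := by
        rw [h1, ← h3, sq]
    _ = _ := by
        rw [← h0, Complex.ofReal_exp]
        simp only [← Complex.exp_add]
        congr 1
        push_cast
        ring

variable {Φ : IntermediateField ℚ ℝ}

/-- The elements of `Φ` whose multiplication preserves `L`. -/
def multipliers (L : AddSubgroup Φ) : Subgroup Φˣ where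
  carrier := {v | ∀ a, (v : Φ) * a ∈ L ↔ a ∈ L}
  mul_mem' := fun {v w} hv hw a => by rw [Units.val_mul, mul_assoc, hv, hw]
  one_mem' := fun a => by simp
  inv_mem' := fun {v} hv a => by rw [← hv, Units.mul_inv_cancel_left]

variable {ι : Type*} [Fintype ι]

/-- The exponent of the embedding `σ` of the square of `η`. -/
def sqLog (η : Φ) (σ : Φ →+* ℂ) : ℂ :=
  ((2 * Real.log ‖σ η‖ : ℝ) : ℂ) +
    ((Complex.arg (σ η) - Complex.arg (ComplexEmbedding.conjugate σ η) : ℝ) : ℂ) * Complex.I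

theorem exp_sqLog {η : Φ} (hη : η ≠ 0) (σ : Φ →+* ℂ) : Complex.exp (sqLog η σ) = σ η ^ 2 := by
  have : σ η ≠ 0 := by simpa using hη
  rw [sq_eq_exp this, sqLog, ComplexEmbedding.conjugate_coe_eq]

theorem sqLog_conjugate (η : Φ) (σ : Φ →+* ℂ) :
    sqLog η (ComplexEmbedding.conjugate σ) = conj (sqLog η σ) := by
  simp only [sqLog, map_add, map_mul, Complex.conj_ofReal, Complex.conj_I,
    ComplexEmbedding.involutive_conjugate Φ σ]
  rw [ComplexEmbedding.conjugate_coe_eq, Complex.norm_conj]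
  push_cast
  ring

open Classical in
/-- The scale with phases `U` and logarithmic coordinates `w` with respect to the squares of the
`η i`. -/
def scaleOf (η : ι → Φ) (U : (Φ →+* ℂ) → UnitAddCircle) (w : ι → ℝ) (σ : Φ →+* ℂ) : ℂ :=
  if σ = incl Φ then 0 else
    Complex.exp (∑ i, (w i : ℂ) * sqLog (η i) σ) *
      AddCircle.toCircle (U σ - U (ComplexEmbedding.conjugate σ))

theorem scaleOf_incl (η : ι → Φ) (U : (Φ →+* ℂ) → UnitAddCircle) (w : ι → ℝ) :
    scaleOf η U w (incl Φ) = 0 := if_pos rfl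

theorem scaleOf_of_ne (η : ι → Φ) (U : (Φ →+* ℂ) → UnitAddCircle) (w : ι → ℝ) {σ : Φ →+* ℂ}
    (hσ : σ ≠ incl Φ) : scaleOf η U w σ = Complex.exp (∑ i, (w i : ℂ) * sqLog (η i) σ) *
      AddCircle.toCircle (U σ - U (ComplexEmbedding.conjugate σ)) := if_neg hσ

theorem scaleOf_conjugate (η : ι → Φ) (U : (Φ →+* ℂ) → UnitAddCircle) (w : ι → ℝ)
    (σ : Φ →+* ℂ) :
    scaleOf η U w (ComplexEmbedding.conjugate σ) = conj (scaleOf η U w σ) := by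
  by_cases hσ : σ = incl Φ
  · rw [hσ, (conjugate_eq_incl_iff _).2 rfl, scaleOf_incl, map_zero]
  · rw [scaleOf_of_ne η U w hσ, scaleOf_of_ne η U w (mt (conjugate_eq_incl_iff σ).1 hσ), map_mul,
      ← Complex.exp_conj, map_sum, ComplexEmbedding.involutive_conjugate Φ σ,
      ← neg_sub (U σ), AddCircle.toCircle_neg, Circle.coe_inv_eq_conj]
    simp only [map_mul, Complex.conj_ofReal, sqLog_conjugate]

/-- The unit adapted to the scale `t`. -/
def unitAt (η : ι → Φˣ) (β : ι → ℝ) (t : ℝ) : Φˣ :=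
  ∏ i, (η i ^ 2) ^ (-⌊β i * Real.log t⌋)

theorem unitAt_pos (η : ι → Φˣ) (β : ι → ℝ) (t : ℝ) : 0 < ((unitAt η β t : Φ) : ℝ) := by
  have h : ((unitAt η β t : Φ) : ℝ) =
      ∏ i, (((η i : Φ) : ℝ) ^ 2) ^ (-⌊β i * Real.log t⌋) := by
    simp only [unitAt, Units.coe_prod, Units.val_zpow_eq_zpow_val, Units.val_pow_eq_pow_val]
    push_cast
    rfl
  rw [h]
  refine Finset.prod_pos fun i _ => zpow_pos ?_ _
  have : ((η i : Φ) : ℝ) ≠ 0 := by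
    exact_mod_cast (η i).ne_zero
  positivity

/-- Write each exponent `-⌊β i * log t⌋` as `fract (β i * log t) - β i * log t`. The fractional
parts give the cube coordinates; in the remaining sum, `hβ` makes the real part `log t`, which
cancels the division by `t`, and the imaginary part is a phase linear in `log t`. -/
theorem map_unitAt_div (η : ι → Φˣ) (β : ι → ℝ) {t : ℝ} (ht : 0 < t) {σ : Φ →+* ℂ}
    (hσ : σ ≠ incl Φ) (hβ : ∑ i, β i * (2 * Real.log ‖σ (η i)‖) = -1) :
    σ (unitAt η β t) / t = scaleOf (fun i => (η i : Φ))
      (fun τ => ((-(∑ i, β i * Complex.arg (τ (η i))) / (2 * Real.pi) * Real.log t : ℝ) :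
        UnitAddCircle)) (fun i => Int.fract (β i * Real.log t)) σ := by
  have h1 : σ (unitAt η β t) =
      Complex.exp (∑ i, -((⌊β i * Real.log t⌋ : ℤ) : ℂ) * sqLog (η i : Φ) σ) := by
    simp only [unitAt, Units.coe_prod, Units.val_zpow_eq_zpow_val, Units.val_pow_eq_pow_val,
      map_prod, map_zpow₀, map_pow, Complex.exp_sum]
    refine Finset.prod_congr rfl fun i _ => ?_
    rw [← exp_sqLog (η i).ne_zero, ← Complex.exp_int_mul]
    push_cast
    rfl
  have h2 : (t : ℂ)⁻¹ = Complex.exp (-((Real.log t : ℝ) : ℂ)) := by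
    rw [Complex.exp_neg, ← Complex.ofReal_exp, Real.exp_log ht]
  have hβ' : ∑ i, (β i : ℂ) * ((2 * Real.log ‖σ (η i)‖ : ℝ) : ℂ) = -1 := by
    exact_mod_cast hβ
  have hpi : (Real.pi : ℂ) ≠ 0 := by exact_mod_cast Real.pi_ne_zero
  rw [scaleOf_of_ne _ _ _ hσ, ← AddCircle.coe_sub, AddCircle.toCircle_apply_mk, Circle.coe_exp,
    div_eq_mul_inv, h1, h2, ← Complex.exp_add, ← Complex.exp_add]
  congr 1
  have h3 : (((2 * Real.pi / 1 * (-(∑ i, β i * Complex.arg (σ (η i))) / (2 * Real.pi) * Real.log t -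
      -(∑ i, β i * Complex.arg (ComplexEmbedding.conjugate σ (η i))) / (2 * Real.pi) *
        Real.log t) : ℝ) : ℂ)) * Complex.I = -(Real.log t : ℂ) * ∑ i, (β i : ℂ) *
      (((Complex.arg (σ (η i)) - Complex.arg (ComplexEmbedding.conjugate σ (η i)) : ℝ) : ℂ) *
        Complex.I) := by
    have e : ∑ i, (β i : ℂ) *
      (((Complex.arg (σ (η i)) - Complex.arg (ComplexEmbedding.conjugate σ (η i)) : ℝ) : ℂ) *
        Complex.I) = (∑ i, (β i : ℂ) * Complex.arg (σ (η i)) -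
          ∑ i, (β i : ℂ) * Complex.arg (ComplexEmbedding.conjugate σ (η i))) * Complex.I := by
      rw [← Finset.sum_sub_distrib, Finset.sum_mul]
      refine Finset.sum_congr rfl fun i _ => ?_
      push_cast
      ring
    rw [e]
    push_cast
    field_simp
    ring
  rw [h3, neg_mul_comm, ← Finset.sum_neg_distrib, Finset.mul_sum]
  have h4 : -((Real.log t : ℝ) : ℂ) = (Real.log t : ℂ) *
      ∑ i, (β i : ℂ) * ((2 * Real.log ‖σ (η i)‖ : ℝ) : ℂ) := by
    rw [hβ', mul_neg_one]
  rw [h4, Finset.mul_sum, ← Finset.sum_add_distrib, ← Finset.sum_add_distrib]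
  refine Finset.sum_congr rfl fun i _ => ?_
  rw [← Int.self_sub_floor, sqLog]
  push_cast
  ring

theorem unitAt_mem_multipliers {L : AddSubgroup Φ} {η : ι → Φˣ} (hη : ∀ i, η i ∈ multipliers L)
    (β : ι → ℝ) (t : ℝ) : unitAt η β t ∈ multipliers L :=
  Subgroup.prod_mem _ fun i _ => Subgroup.zpow_mem _ (Subgroup.pow_mem _ (hη i) _) _

variable [NumberField Φ]

/-- A bound for all the exponents `sqLog (η i) σ`. -/
def sqLogSize (η : ι → Φ) : ℝ := ∑ σ : Φ →+* ℂ, ∑ i, ‖sqLog (η i) σ‖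

theorem sum_norm_sqLog_le (η : ι → Φ) (σ : Φ →+* ℂ) : ∑ i, ‖sqLog (η i) σ‖ ≤ sqLogSize η :=
  Finset.single_le_sum (f := fun σ : Φ →+* ℂ => ∑ i, ‖sqLog (η i) σ‖)
    (fun _ _ => Finset.sum_nonneg fun _ _ => norm_nonneg _) (Finset.mem_univ σ)

theorem norm_sum_mul_sqLog_le (η : ι → Φ) {w : ι → ℝ} {δ : ℝ} (hδ : 0 ≤ δ) (hw : ∀ i, |w i| ≤ δ)
    (σ : Φ →+* ℂ) : ‖∑ i, (w i : ℂ) * sqLog (η i) σ‖ ≤ δ * sqLogSize η := by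
  refine (norm_sum_le_of_le _ (f := fun i => (w i : ℂ) * sqLog (η i) σ)
    (n := fun i => δ * ‖sqLog (η i) σ‖) fun i _ => ?_).trans ?_
  · rw [norm_mul, Complex.norm_real]
    exact mul_le_mul_of_nonneg_right (hw i) (norm_nonneg _)
  · rw [← Finset.mul_sum]
    exact mul_le_mul_of_nonneg_left (sum_norm_sqLog_le η σ) hδ

theorem isScale_scaleOf (η : ι → Φ) (U : (Φ →+* ℂ) → UnitAddCircle) {w : ι → ℝ}
    (hw : ∀ i, |w i| ≤ 1) :
    IsScale (Real.exp (-sqLogSize η)) (Real.exp (sqLogSize η)) 0 (scaleOf η U w) := by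
  have key : ∀ σ, |(∑ i, (w i : ℂ) * sqLog (η i) σ).re| ≤ sqLogSize η := fun σ =>
    (Complex.abs_re_le_norm _).trans
      ((norm_sum_mul_sqLog_le η zero_le_one hw σ).trans_eq (one_mul _))
  refine ⟨scaleOf_conjugate η U w, fun σ hσ => ?_, fun σ hσ => ?_, by simp [scaleOf_incl]⟩
  · rw [scaleOf_of_ne η U w hσ, norm_mul, Circle.norm_coe, mul_one, Complex.norm_exp]
    exact Real.exp_le_exp.2 (neg_le_of_abs_le (key σ))
  · rw [scaleOf_of_ne η U w hσ, norm_mul, Circle.norm_coe, mul_one, Complex.norm_exp]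
    exact Real.exp_le_exp.2 (le_of_abs_le (key σ))

theorem norm_scaleOf_sub_le (η : ι → Φ) {U U' : (Φ →+* ℂ) → UnitAddCircle} {w w' : ι → ℝ}
    (hw : ∀ i, |w i| ≤ 1) (hw' : ∀ i, |w' i| ≤ 1) {δ : ℝ} (hδ : 0 ≤ δ)
    (hU : ∀ σ, ‖U σ - U' σ‖ ≤ δ) (hww' : ∀ i, |w i - w' i| ≤ δ) (σ : Φ →+* ℂ) :
    ‖scaleOf η U w σ - scaleOf η U' w' σ‖ ≤
      Real.exp (sqLogSize η) * (sqLogSize η + 4 * Real.pi) * δ := by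
  have hS : 0 ≤ sqLogSize η :=
    Finset.sum_nonneg fun _ _ => Finset.sum_nonneg fun _ _ => norm_nonneg _
  by_cases hσ : σ = incl Φ
  · rw [hσ, scaleOf_incl, scaleOf_incl, sub_zero, norm_zero]
    have := Real.pi_pos
    positivity
  rw [scaleOf_of_ne η U w hσ, scaleOf_of_ne η U' w' hσ]
  set A := ∑ i, (w i : ℂ) * sqLog (η i) σ with hA
  set A' := ∑ i, (w' i : ℂ) * sqLog (η i) σ with hA'
  set T := (AddCircle.toCircle (U σ - U (ComplexEmbedding.conjugate σ)) : ℂ) with hT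
  set T' := (AddCircle.toCircle (U' σ - U' (ComplexEmbedding.conjugate σ)) : ℂ) with hT'
  have h1 : A.re ≤ sqLogSize η := (Complex.re_le_norm _).trans
    ((norm_sum_mul_sqLog_le η zero_le_one hw σ).trans_eq (one_mul _))
  have h2 : A'.re ≤ sqLogSize η := (Complex.re_le_norm _).trans
    ((norm_sum_mul_sqLog_le η zero_le_one hw' σ).trans_eq (one_mul _))
  have h3 : ‖A - A'‖ ≤ δ * sqLogSize η := by
    have : A - A' = ∑ i, ((w i - w' i : ℝ) : ℂ) * sqLog (η i) σ := by
      rw [hA, hA', ← Finset.sum_sub_distrib]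
      refine Finset.sum_congr rfl fun i _ => ?_
      push_cast
      ring
    rw [this]
    exact norm_sum_mul_sqLog_le η hδ hww' σ
  -- The angle is a difference of two values of `U`, which doubles the Lipschitz constant `2 * π` of
  -- `toCircle`.
  have h4 : ‖T - T'‖ ≤ 4 * Real.pi * δ := by
    refine (norm_toCircle_sub_le _ _).trans ?_
    rw [sub_sub_sub_comm]
    have := norm_sub_le_of_le (hU σ) (hU (ComplexEmbedding.conjugate σ))
    have h5 := mul_le_mul_of_nonneg_left this Real.two_pi_pos.le
    linarith
  have h5 : ‖T‖ = 1 := Circle.norm_coe _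
  have h6 : Complex.exp A * T - Complex.exp A' * T' =
      (Complex.exp A - Complex.exp A') * T + Complex.exp A' * (T - T') := by ring
  rw [h6]
  refine (norm_add_le _ _).trans ?_
  rw [norm_mul, norm_mul, h5, mul_one]
  have h7 := (norm_exp_sub_exp_le h1 h2).trans
    (mul_le_mul_of_nonneg_left h3 (Real.exp_nonneg _))
  have h8 : ‖Complex.exp A'‖ ≤ Real.exp (sqLogSize η) := by
    rw [Complex.norm_exp]
    exact Real.exp_le_exp.2 h2
  have h9 := mul_le_mul h8 h4 (norm_nonneg _) (Real.exp_nonneg _)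
  calc _ ≤ Real.exp (sqLogSize η) * (δ * sqLogSize η) +
        Real.exp (sqLogSize η) * (4 * Real.pi * δ) := add_le_add h7 h9
    _ = _ := by ring

theorem prod_norm_unitAt {η : ι → Φˣ} (hη : ∀ i, ∏ σ : Φ →+* ℂ, ‖σ (η i)‖ = 1)
    (β : ι → ℝ) (t : ℝ) : ∏ σ : Φ →+* ℂ, ‖σ (unitAt η β t)‖ = 1 := by
  simp only [unitAt, Units.coe_prod, Units.val_zpow_eq_zpow_val, Units.val_pow_eq_pow_val,
    map_prod, map_zpow₀, map_pow, norm_prod, norm_zpow, norm_pow]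
  rw [Finset.prod_comm]
  refine Finset.prod_eq_one fun i _ => ?_
  rw [Finset.prod_zpow, Finset.prod_pow, hη, one_pow, one_zpow]

/-- A Lipschitz family of scales, parametrised by a torus and a cube, which contains the points
`1 / t` up to multiplication by lattice-preserving units. -/
theorem exists_scale_family {d : ℕ} (b : Module.Basis (Fin (d + 1)) ℚ Φ) :
    ∃ (Z : (Fin (d + 1) → UnitAddCircle) × (Fin (Units.rank Φ) → unitInterval) →
        (Φ →+* ℂ) → ℂ) (θ : Fin (d + 1) → ℝ) (β : Fin (Units.rank Φ) → ℝ) (c C K D : ℝ),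
      0 < c ∧ 0 ≤ C ∧ 0 ≤ K ∧ 0 ≤ D ∧ (∀ p, IsScale c C 0 (Z p)) ∧
      (∀ p q σ, ‖Z p σ - Z q σ‖ ≤ K * dist p q) ∧
      ∀ t : ℝ, 0 < t → ∃ u : Φ, 0 < (u : ℝ) ∧
        (∀ a, u * a ∈ basisLattice b ↔ a ∈ basisLattice b) ∧
        (∀ σ : Φ →+* ℂ, σ ≠ incl Φ → σ u / t =
          Z (fun j => ((θ j * Real.log t : ℝ) : UnitAddCircle),
            fun j => fractI (β j * Real.log t)) σ) ∧ (1 ≤ t → (u : ℝ) ≤ D) := by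
  classical
  obtain ⟨η', β, hη0, hηL, hη1, hβ⟩ := exists_units_mul_mem_iff b
  set η : Fin (Units.rank Φ) → Φˣ := fun i => Units.mk0 (η' i) (hη0 i)
  set s := sqLogSize (fun i => (η i : Φ)) with hs
  have hs0 : 0 ≤ s := Finset.sum_nonneg fun _ _ => Finset.sum_nonneg fun _ _ => norm_nonneg _
  let e : (Φ →+* ℂ) ≃ Fin (d + 1) :=
    Fintype.equivOfCardEq (by rw [card_embeddings_eq b, Fintype.card_fin])
  have hI : ∀ x : unitInterval, |(x : ℝ)| ≤ 1 := fun x => by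
    rw [abs_of_nonneg x.2.1]; exact x.2.2
  set Z : (Fin (d + 1) → UnitAddCircle) × (Fin (Units.rank Φ) → unitInterval) → (Φ →+* ℂ) → ℂ :=
    fun p => scaleOf (fun i => (η i : Φ)) (fun σ => p.1 (e σ)) (fun i => (p.2 i : ℝ)) with hZ
  have hscale : ∀ p, IsScale (Real.exp (-s)) (Real.exp s) 0 (Z p) := fun p =>
    isScale_scaleOf _ _ fun i => hI _
  -- There is one angle for each embedding, hence a torus of dimension `d + 1`.
  refine ⟨Z, fun j => -(∑ i, β i * Complex.arg (e.symm j (η i))) / (2 * Real.pi), β,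
    Real.exp (-s), Real.exp s, Real.exp s * (s + 4 * Real.pi), Real.exp s ^ d, Real.exp_pos _,
    Real.exp_nonneg _, ?_, by positivity, hscale, fun p q σ => ?_, fun t ht => ?_⟩
  · have := Real.pi_pos
    positivity
  · refine norm_scaleOf_sub_le _ (fun i => hI _) (fun i => hI _) dist_nonneg (fun τ => ?_)
      (fun i => ?_) σ
    · rw [← dist_eq_norm]
      exact (dist_le_pi_dist p.1 q.1 (e τ)).trans (le_max_left _ _)
    · rw [← Real.dist_eq]
      exact (dist_le_pi_dist p.2 q.2 i).trans (le_max_right _ _)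
  · have hmap : ∀ σ : Φ →+* ℂ, σ ≠ incl Φ → σ (unitAt η β t) / t =
        Z (fun j => ((-(∑ i, β i * Complex.arg (e.symm j (η i))) / (2 * Real.pi) * Real.log t : ℝ) :
          UnitAddCircle), fun j => fractI (β j * Real.log t)) σ := by
      intro σ hσ
      rw [map_unitAt_div η β ht hσ (hβ σ hσ), hZ]
      simp only [Equiv.symm_apply_apply]
      rfl
    refine ⟨(unitAt η β t : Φ), unitAt_pos η β t,
      unitAt_mem_multipliers (L := basisLattice b) (η := η) (fun i => hηL i) β t, hmap,
      fun ht1 => ?_⟩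
    -- All conjugates have product of absolute value `1`, and each of the `d` others is at least
    -- `exp (-s) * t ≥ exp (-s)`; this bounds `u` by `exp s ^ d`.
    have h1 := prod_norm_unitAt (η := η) hη1 β t
    rw [← Finset.mul_prod_erase _ _ (Finset.mem_univ (incl Φ)), norm_incl,
      abs_of_pos (unitAt_pos η β t)] at h1
    have h2 : Real.exp (-s) ^ d ≤ ∏ σ ∈ Finset.univ.erase (incl Φ), ‖σ (unitAt η β t)‖ := by
      have hcard : (Finset.univ.erase (incl Φ)).card = d := by
        rw [Finset.card_erase_of_mem (Finset.mem_univ _), Finset.card_univ, card_embeddings_eq b,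
          Nat.add_sub_cancel]
      rw [← hcard, ← Finset.prod_const]
      refine Finset.prod_le_prod (fun _ _ => Real.exp_nonneg _) fun σ hσ => ?_
      have hσ' := Finset.ne_of_mem_erase hσ
      have h3 : Real.exp (-s) ≤ ‖σ (unitAt η β t) / t‖ := by
        rw [hmap σ hσ']
        exact (hscale _).le_norm σ hσ'
      rw [norm_div, Complex.norm_real, Real.norm_of_nonneg ht.le,
        le_div_iff₀ ht] at h3
      exact (le_mul_of_one_le_right (Real.exp_nonneg _) ht1).trans h3
    have h4 : ((unitAt η β t : Φ) : ℝ) * Real.exp (-s) ^ d ≤ 1 := by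
      rw [← h1]
      exact mul_le_mul_of_nonneg_left h2 (unitAt_pos η β t).le
    rw [Real.exp_neg, inv_pow, ← div_eq_mul_inv, div_le_one (by positivity)] at h4
    exact h4

end Scales

end Spacings

end

noncomputable section

namespace Spacings

/-! ### From the ordered fractional parts to lattice neighbours. -/

section Points

variable {d : ℕ} {Φ : IntermediateField ℚ ℝ} (b : Module.Basis (Fin (d + 1)) ℚ Φ)

/-- The element of the lattice in `[0, 1)` with the given coordinates of positive index. -/
def pointElt (m : Fin d → ℤ) : Φ :=
  ∑ j, ((Fin.cons (-⌊∑ i, (m i : ℝ) * (b i.succ : ℝ)⌋) m : Fin (d + 1) → ℤ) j : Φ) * b j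

theorem repr_sum_intCast_mul (n : Fin (d + 1) → ℤ) (j : Fin (d + 1)) :
    b.repr (∑ j, (n j : Φ) * b j) j = n j := by
  have : ∑ j, (n j : Φ) * b j = ∑ j, (n j : ℚ) • b j :=
    Finset.sum_congr rfl fun j _ => by rw [Algebra.smul_def]; simp
  rw [this, b.repr_sum_self]

theorem repr_pointElt (m : Fin d → ℤ) (i : Fin d) : b.repr (pointElt b m) i.succ = m i := by
  rw [pointElt, repr_sum_intCast_mul, Fin.cons_succ]

variable {b} {ω : Fin d → ℝ}

theorem coe_sum_intCast_mul (hb_zero : ((b 0 : Φ) : ℝ) = 1)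
    (hb_succ : ∀ i : Fin d, ((b i.succ : Φ) : ℝ) = ω i) (n : Fin (d + 1) → ℤ) :
    ((∑ j, (n j : Φ) * b j : Φ) : ℝ) = n 0 + ∑ i, (n (Fin.succ i) : ℝ) * ω i := by
  rw [Fin.sum_univ_succ]
  push_cast
  rw [hb_zero, mul_one]
  simp_rw [hb_succ]

theorem coe_pointElt (hb_zero : ((b 0 : Φ) : ℝ) = 1)
    (hb_succ : ∀ i : Fin d, ((b i.succ : Φ) : ℝ) = ω i) (m : Fin d → ℤ) :
    ((pointElt b m : Φ) : ℝ) = fracDot ω m := by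
  rw [pointElt, coe_sum_intCast_mul hb_zero hb_succ]
  simp only [Fin.cons_zero, Fin.cons_succ, hb_succ]
  rw [fracDot, ← Int.self_sub_floor]
  push_cast
  ring

theorem fracDot_injective (hb_zero : ((b 0 : Φ) : ℝ) = 1)
    (hb_succ : ∀ i : Fin d, ((b i.succ : Φ) : ℝ) = ω i) : Function.Injective (fracDot ω) := by
  intro m m' h
  rw [← coe_pointElt hb_zero hb_succ, ← coe_pointElt hb_zero hb_succ] at h
  have h1 : pointElt b m = pointElt b m' := Subtype.ext h
  ext i
  have h2 := repr_pointElt b m i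
  rw [h1, repr_pointElt] at h2
  exact_mod_cast h2.symm

variable {R : Set (Fin d → ℝ)} (hR : Bornology.IsBounded R) {t : ℝ}

theorem mem_M {m : Fin d → ℤ} : m ∈ M hR t ↔ (fun i => (m i : ℝ)) ∈ t • R :=
  Set.Finite.mem_toFinset _

theorem mem_M_iff_inv_smul_mem (ht : 0 < t) {m : Fin d → ℤ} :
    m ∈ M hR t ↔ t⁻¹ • (fun i => (m i : ℝ)) ∈ R := by
  rw [mem_M, Set.mem_smul_set_iff_inv_smul_mem₀ ht.ne']

theorem length_points : (points ω hR t).length = (M hR t).card := by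
  rw [points, Multiset.length_sort, Multiset.card_map]
  rfl

theorem y_eq_getElem {i : ℕ} (hi : i < (M hR t).card) :
    y ω hR t i = (points ω hR t)[i]'(by rwa [length_points]) := by
  rw [y, List.getD_eq_getElem]

theorem exists_fracDot_eq_y {i : ℕ} (hi : i < (M hR t).card) :
    ∃ m ∈ M hR t, fracDot ω m = y ω hR t i := by
  have h1 : y ω hR t i ∈ points ω hR t := by
    rw [y_eq_getElem hR hi]
    exact List.getElem_mem _
  rw [points, Multiset.mem_sort, Multiset.mem_map] at h1
  exact h1

theorem exists_y_eq_fracDot {m : Fin d → ℤ} (hm : m ∈ M hR t) :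
    ∃ i < (M hR t).card, y ω hR t i = fracDot ω m := by
  have h1 : fracDot ω m ∈ points ω hR t := by
    rw [points, Multiset.mem_sort]
    exact Multiset.mem_map_of_mem _ hm
  obtain ⟨i, hi, h⟩ := List.getElem_of_mem h1
  rw [length_points] at hi
  exact ⟨i, hi, by rw [y_eq_getElem hR hi, h]⟩

theorem y_lt_y (hinj : Function.Injective (fracDot ω)) {i j : ℕ} (hij : i < j)
    (hj : j < (M hR t).card) : y ω hR t i < y ω hR t j := by
  have h1 : (points ω hR t).Pairwise (· ≤ ·) := Multiset.pairwise_sort _ _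
  have h2 : (points ω hR t).Nodup := by
    have : ((points ω hR t : List ℝ) : Multiset ℝ).Nodup := by
      rw [points, Multiset.sort_eq]
      exact (M hR t).nodup.map hinj
    exact this
  rw [y_eq_getElem hR (hij.trans hj), y_eq_getElem hR hj]
  refine lt_of_le_of_ne (List.pairwise_iff_getElem.1 h1 i j _ _ hij) fun h => hij.ne ?_
  exact (List.Nodup.getElem_inj_iff h2).1 h

theorem not_fracDot_between (hinj : Function.Injective (fracDot ω)) {i : ℕ}
    (hi : i + 1 < (M hR t).card) {m : Fin d → ℤ} (hm : m ∈ M hR t)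
    (h1 : y ω hR t i < fracDot ω m) : y ω hR t (i + 1) ≤ fracDot ω m := by
  obtain ⟨k, hk, hkm⟩ := exists_y_eq_fracDot (ω := ω) hR hm
  rw [← hkm] at h1 ⊢
  have hik : i < k := by
    by_contra! h
    rcases h.eq_or_lt with rfl | h
    · exact lt_irrefl _ h1
    · exact lt_asymm h1 (y_lt_y hR hinj h (by omega))
  rcases (Nat.succ_le_of_lt hik).eq_or_lt with h | h
  · exact h ▸ le_rfl
  · exact (y_lt_y hR hinj h hk).le

/-- For bounded `t` there are finitely many ratios. -/
theorem exists_finset_gapRatio (hb_zero : ((b 0 : Φ) : ℝ) = 1)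
    (hb_succ : ∀ i : Fin d, ((b i.succ : Φ) : ℝ) = ω i) (T : ℝ) :
    ∃ S : Finset Φ, ∀ t : ℝ, 0 < t → t ≤ T → ∀ i : ℕ, i + 2 < (M hR t).card →
      ∃ x ∈ S, gapRatio ω hR t i = (x : ℝ) := by
  classical
  obtain ⟨C, hC⟩ := hR.exists_norm_le
  -- One ball contains `t • R` for all `0 < t ≤ T`, so all spacings are differences of elements of
  -- one finite set.
  have hfin : {m : Fin d → ℤ | (fun i => (m i : ℝ)) ∈
      (1 : ℝ) • Metric.closedBall (0 : Fin d → ℝ) (T * C)}.Finite :=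
    latticePoints_finite Metric.isBounded_closedBall 1
  set G := hfin.toFinset.image (pointElt b)
  refine ⟨quotients ((G ×ˢ G).image fun a => a.1 - a.2), fun t ht htT i hi => ?_⟩
  have hmem : ∀ m ∈ M hR t, pointElt b m ∈ G := fun m hm => by
    refine Finset.mem_image_of_mem _ ((Set.Finite.mem_toFinset _).2 ?_)
    rw [mem_M] at hm
    obtain ⟨p, hp, h⟩ := hm
    change (fun i => (m i : ℝ)) ∈ (1 : ℝ) • Metric.closedBall (0 : Fin d → ℝ) (T * C)
    rw [one_smul, ← h, mem_closedBall_zero_iff]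
    simp only [norm_smul, Real.norm_of_nonneg ht.le]
    exact mul_le_mul htT (hC p hp) (norm_nonneg _) (ht.le.trans htT)
  have hgap : ∀ i, i + 1 < (M hR t).card →
      ∃ a ∈ (G ×ˢ G).image fun a => a.1 - a.2, gap ω hR t i = ((a : Φ) : ℝ) := by
    intro i hi
    obtain ⟨m₀, hm₀, h₀⟩ := exists_fracDot_eq_y (ω := ω) hR (t := t) (i := i) (by omega)
    obtain ⟨m₁, hm₁, h₁⟩ := exists_fracDot_eq_y (ω := ω) hR (t := t) (i := i + 1) hi
    refine ⟨pointElt b m₁ - pointElt b m₀, Finset.mem_image.2 ⟨(pointElt b m₁, pointElt b m₀),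
      Finset.mem_product.2 ⟨hmem _ hm₁, hmem _ hm₀⟩, rfl⟩, ?_⟩
    push_cast
    rw [coe_pointElt hb_zero hb_succ, coe_pointElt hb_zero hb_succ, h₁, h₀, gap]
  obtain ⟨a, ha, ea⟩ := hgap i (by omega)
  obtain ⟨c, hc, ec⟩ := hgap (i + 1) (by omega)
  refine ⟨c / a, Finset.mem_image.2 ⟨(c, a), Finset.mem_product.2 ⟨hc, ha⟩, rfl⟩, ?_⟩
  rw [gapRatio, ea, ec]
  push_cast
  rfl

theorem pointElt_mem_basisLattice (m : Fin d → ℤ) : pointElt b m ∈ basisLattice b :=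
  sum_intCast_mul_mem_basisLattice b _

theorem fracDot_eq_fract (hb_zero : ((b 0 : Φ) : ℝ) = 1)
    (hb_succ : ∀ i : Fin d, ((b i.succ : Φ) : ℝ) = ω i) {a : Φ} (ha : a ∈ basisLattice b)
    {n : Fin d → ℤ} (hn : ∀ i, b.repr a i.succ = n i) : fracDot ω n = Int.fract (a : ℝ) := by
  choose k hk using (mem_basisLattice b).1 ha
  have h1 : a = ∑ j, (k j : Φ) * b j := by
    conv_lhs => rw [← b.sum_repr a]
    refine Finset.sum_congr rfl fun j _ => ?_
    rw [← hk, Algebra.smul_def, map_intCast]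
  have h2 : (a : ℝ) = k 0 + ∑ i, (k (Fin.succ i) : ℝ) * ω i := by
    rw [← coe_sum_intCast_mul hb_zero hb_succ, ← h1]
  have h3 : ∀ i, k (Fin.succ i) = n i := fun i => by
    have := (hk i.succ).trans (hn i)
    exact_mod_cast this
  rw [h2, Int.fract_intCast_add, fracDot]
  simp_rw [h3]

theorem exists_coords {a : Φ} (ha : a ∈ basisLattice b) :
    ∃ n : Fin d → ℤ, ∀ i, b.repr a i.succ = n i := by
  choose k hk using (mem_basisLattice b).1 ha
  exact ⟨fun i => k i.succ, fun i => (hk _).symm⟩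

variable [NumberField Φ]

theorem disp_inv_eq {a : Φ} {n : Fin d → ℤ} (hn : ∀ i, b.repr a i.succ = n i) :
    disp b (fun _ => ((t⁻¹ : ℝ) : ℂ)) a = t⁻¹ • (fun i => (n i : ℝ)) := by
  ext i
  have h1 := disp_one b a i
  rw [hn] at h1
  simp only [disp, one_mul, mul_assoc, Pi.smul_apply, smul_eq_mul] at h1 ⊢
  rw [← Finset.mul_sum, Complex.re_ofReal_mul, h1, Rat.cast_intCast]

/-- Consecutive points are neighbours in the sense of `IsNext`. -/
theorem isNext_pointElt_sub (hb_zero : ((b 0 : Φ) : ℝ) = 1)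
    (hb_succ : ∀ i : Fin d, ((b i.succ : Φ) : ℝ) = ω i) (ht : 0 < t) {i : ℕ}
    (hi : i + 1 < (M hR t).card) {m m' : Fin d → ℤ} (hm : m ∈ M hR t) (hm' : m' ∈ M hR t)
    (hmy : fracDot ω m = y ω hR t i) (hmy' : fracDot ω m' = y ω hR t (i + 1)) :
    IsNext (basisLattice b) R (disp b fun _ => ((t⁻¹ : ℝ) : ℂ)) (t⁻¹ • fun i => (m i : ℝ))
        (pointElt b m' - pointElt b m) ∧
      IsNext (basisLattice b) R (-disp b fun _ => ((t⁻¹ : ℝ) : ℂ)) (t⁻¹ • fun i => (m' i : ℝ))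
        (pointElt b m' - pointElt b m) := by
  have hinj := fracDot_injective hb_zero hb_succ
  have hL : pointElt b m' - pointElt b m ∈ basisLattice b :=
    AddSubgroup.sub_mem _ (pointElt_mem_basisLattice m') (pointElt_mem_basisLattice m)
  have hval : ((pointElt b m' - pointElt b m : Φ) : ℝ) = y ω hR t (i + 1) - y ω hR t i := by
    push_cast
    rw [coe_pointElt hb_zero hb_succ, coe_pointElt hb_zero hb_succ, hmy, hmy']
  have hpos : 0 < ((pointElt b m' - pointElt b m : Φ) : ℝ) := by
    rw [hval]
    exact sub_pos.2 (y_lt_y hR hinj (Nat.lt_succ_self i) hi)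
  have hdisp := disp_inv_eq (b := b) (t := t) (a := pointElt b m' - pointElt b m)
    (n := fun i => m' i - m i) (fun i => by
      rw [map_sub, Finsupp.sub_apply, repr_pointElt, repr_pointElt]
      push_cast
      rfl)
  have hadd : (t⁻¹ • fun i => (m i : ℝ)) + t⁻¹ • (fun i => ((m' i - m i : ℤ) : ℝ)) =
      t⁻¹ • fun i => (m' i : ℝ) := by
    rw [← smul_add]
    congr 1
    ext i
    simp
  have hsub : (t⁻¹ • fun i => (m' i : ℝ)) + -(t⁻¹ • (fun i => ((m' i - m i : ℤ) : ℝ))) =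
      t⁻¹ • fun i => (m i : ℝ) := by
    rw [← hadd]
    abel
  have hfm := coe_pointElt hb_zero hb_succ m
  have hfm' := coe_pointElt hb_zero hb_succ m'
  have hy0 : 0 ≤ y ω hR t i := hmy ▸ Int.fract_nonneg _
  have hy1 : y ω hR t (i + 1) < 1 := hmy' ▸ Int.fract_lt_one _
  refine ⟨⟨hL, hpos, ?_, fun ν hν hν0 hνR => ?_⟩, ⟨hL, hpos, ?_, fun ν hν hν0 hνR => ?_⟩⟩
  · rw [hdisp, hadd]
    exact (mem_M_iff_inv_smul_mem hR ht).1 hm'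
  -- A smaller `ν` would give a point strictly between the two. No reduction modulo `1` interferes:
  -- `y i + ν` is positioned below `y (i + 1) < 1`.
  · by_contra! hlt
    obtain ⟨n, hn⟩ := exists_coords hν
    rw [disp_inv_eq hn, ← smul_add] at hνR
    have hmem : (fun i => m i + n i) ∈ M hR t := by
      rw [mem_M_iff_inv_smul_mem hR ht]
      convert hνR using 2
      ext i
      simp
    have hf := fracDot_eq_fract hb_zero hb_succ
      (AddSubgroup.add_mem _ (pointElt_mem_basisLattice m) hν) (n := fun i => m i + n i)
      (fun i => by
        rw [map_add, Finsupp.add_apply, repr_pointElt, hn]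
        push_cast
        rfl)
    push_cast at hf
    rw [hfm, hmy, Int.fract_eq_self.2 ⟨by linarith, by linarith⟩] at hf
    have := not_fracDot_between hR hinj hi hmem (by rw [hf]; linarith)
    rw [hf] at this
    linarith
  · rw [Pi.neg_apply, hdisp, hsub]
    exact (mem_M_iff_inv_smul_mem hR ht).1 hm
  · by_contra! hlt
    obtain ⟨n, hn⟩ := exists_coords hν
    rw [Pi.neg_apply, disp_inv_eq hn, ← smul_neg, ← smul_add] at hνR
    have hmem : (fun i => m' i - n i) ∈ M hR t := by
      rw [mem_M_iff_inv_smul_mem hR ht]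
      convert hνR using 2
      ext i
      simp [sub_eq_add_neg]
    have hf := fracDot_eq_fract hb_zero hb_succ
      (AddSubgroup.sub_mem _ (pointElt_mem_basisLattice m') hν) (n := fun i => m' i - n i)
      (fun i => by
        rw [map_sub, Finsupp.sub_apply, repr_pointElt, hn]
        push_cast
        rfl)
    push_cast at hf
    rw [hfm', hmy', Int.fract_eq_self.2 ⟨by linarith, by linarith⟩] at hf
    have := not_fracDot_between hR hinj hi hmem (by rw [hf]; linarith)
    rw [hf] at this
    linarith

theorem gapRatio_eq_iff_hasRatio (hb_zero : ((b 0 : Φ) : ℝ) = 1)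
    (hb_succ : ∀ i : Fin d, ((b i.succ : Φ) : ℝ) = ω i) (ht : 0 < t) {i : ℕ}
    (hi : i + 2 < (M hR t).card) {m : Fin d → ℤ} (hm : m ∈ M hR t)
    (hmy : fracDot ω m = y ω hR t (i + 1)) (x : Φ) :
    gapRatio ω hR t i = (x : ℝ) ↔
      HasRatio (basisLattice b) R (disp b fun _ => ((t⁻¹ : ℝ) : ℂ))
        (t⁻¹ • fun i => (m i : ℝ)) x := by
  obtain ⟨m₀, hm₀, h₀⟩ := exists_fracDot_eq_y (ω := ω) hR (t := t) (i := i) (by omega)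
  obtain ⟨m₁, hm₁, h₁⟩ := exists_fracDot_eq_y (ω := ω) hR (t := t) (i := i + 2) (by omega)
  have hprev := (isNext_pointElt_sub hR hb_zero hb_succ ht (by omega) hm₀ hm h₀ hmy).2
  have hnext := (isNext_pointElt_sub hR hb_zero hb_succ ht hi hm hm₁ hmy h₁).1
  have e1 : gap ω hR t i = ((pointElt b m - pointElt b m₀ : Φ) : ℝ) := by
    push_cast
    rw [coe_pointElt hb_zero hb_succ, coe_pointElt hb_zero hb_succ, hmy, h₀, gap]
  have e2 : gap ω hR t (i + 1) = ((pointElt b m₁ - pointElt b m : Φ) : ℝ) := by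
    push_cast
    rw [coe_pointElt hb_zero hb_succ, coe_pointElt hb_zero hb_succ, hmy, h₁, gap]
  rw [gapRatio, e1, e2, div_eq_iff hprev.2.1.ne']
  constructor
  · intro h
    exact ⟨_, _, hnext, hprev, Subtype.ext (by push_cast at h ⊢; exact h)⟩
  · rintro ⟨μ, μ', h1, h2, h3⟩
    rw [hnext.unique h1, hprev.unique h2, h3]
    push_cast
    rfl

open Classical in
/-- The number of ratios equal to `x` is, up to an error of at most `2`, the number of points of
`M(t)` with this ratio. -/
theorem card_filter_gapRatio (hb_zero : ((b 0 : Φ) : ℝ) = 1)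
    (hb_succ : ∀ i : Fin d, ((b i.succ : Φ) : ℝ) = ω i) (ht : 0 < t) (x : Φ) :
    ((Finset.range ((M hR t).card - 2)).filter fun i => gapRatio ω hR t i = (x : ℝ)).card ≤
        ((M hR t).filter fun m => HasRatio (basisLattice b) R (disp b fun _ => ((t⁻¹ : ℝ) : ℂ))
          (t⁻¹ • fun i => (m i : ℝ)) x).card ∧
      ((M hR t).filter fun m => HasRatio (basisLattice b) R (disp b fun _ => ((t⁻¹ : ℝ) : ℂ))
          (t⁻¹ • fun i => (m i : ℝ)) x).card ≤
        ((Finset.range ((M hR t).card - 2)).filter fun i => gapRatio ω hR t i = (x : ℝ)).card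
          + 2 := by
  have hinj := fracDot_injective hb_zero hb_succ
  set N := (M hR t).card
  have hg : ∀ i : ℕ, ∃ m, i < N → m ∈ M hR t ∧ fracDot ω m = y ω hR t i := by
    intro i
    by_cases hi : i < N
    · obtain ⟨m, h1, h2⟩ := exists_fracDot_eq_y (ω := ω) hR hi
      exact ⟨m, fun _ => ⟨h1, h2⟩⟩
    · exact ⟨0, fun h => absurd h hi⟩
  choose g hg using hg
  set A := (Finset.range (N - 2)).filter fun i => gapRatio ω hR t i = (x : ℝ) with hA
  set B := (M hR t).filter fun m => HasRatio (basisLattice b) R (disp b fun _ => ((t⁻¹ : ℝ) : ℂ))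
    (t⁻¹ • fun i => (m i : ℝ)) x with hB
  have hiff : ∀ i, i + 2 < N → (gapRatio ω hR t i = (x : ℝ) ↔ HasRatio (basisLattice b) R
      (disp b fun _ => ((t⁻¹ : ℝ) : ℂ)) (t⁻¹ • fun j => (g (i + 1) j : ℝ)) x) := fun i hi =>
    gapRatio_eq_iff_hasRatio hR hb_zero hb_succ ht hi (hg (i + 1) (by omega)).1
      (hg (i + 1) (by omega)).2 x
  constructor
  · refine Finset.card_le_card_of_injOn (fun i => g (i + 1)) (fun i hi => ?_) fun i hi j hj h => ?_
    · obtain ⟨h1, h2⟩ := Finset.mem_filter.1 hi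
      have h3 := Finset.mem_range.1 h1
      exact Finset.mem_filter.2 ⟨(hg (i + 1) (by omega)).1, (hiff i (by omega)).1 h2⟩
    · have h1 := Finset.mem_range.1 (Finset.mem_filter.1 hi).1
      have h2 := Finset.mem_range.1 (Finset.mem_filter.1 hj).1
      have h3 : y ω hR t (i + 1) = y ω hR t (j + 1) := by
        rw [← (hg (i + 1) (by omega)).2, ← (hg (j + 1) (by omega)).2]
        exact congrArg _ h
      rcases lt_trichotomy i j with hij | hij | hij
      · exact absurd h3 (y_lt_y hR hinj (by omega) (by omega)).ne
      · exact hij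
      · exact absurd h3 (y_lt_y hR hinj (by omega) (by omega)).ne'
  · have hsub : B ⊆ A.image (fun i => g (i + 1)) ∪ {g 0, g (N - 1)} := by
      intro m hm
      obtain ⟨hmM, hmr⟩ := Finset.mem_filter.1 hm
      obtain ⟨k, hk, hky⟩ := exists_y_eq_fracDot (ω := ω) hR hmM
      have hgk : g k = m := hinj ((hg k hk).2.trans hky)
      rw [Finset.mem_union]
      by_cases h0 : k = 0
      · right
        rw [← hgk, h0]
        exact Finset.mem_insert_self _ _
      by_cases h1 : k = N - 1
      · right
        rw [← hgk, h1]
        exact Finset.mem_insert_of_mem (Finset.mem_singleton_self _)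
      left
      obtain ⟨i, rfl⟩ := Nat.exists_eq_succ_of_ne_zero h0
      have hi : i + 2 < N := by omega
      refine Finset.mem_image.2 ⟨i, Finset.mem_filter.2 ⟨Finset.mem_range.2 (by omega), ?_⟩, hgk⟩
      rw [hiff i hi]
      rw [← hgk] at hmr
      exact hmr
    calc B.card ≤ _ := Finset.card_le_card hsub
      _ ≤ (A.image fun i => g (i + 1)).card + ({g 0, g (N - 1)} : Finset _).card :=
        Finset.card_union_le _ _
      _ ≤ A.card + 2 := add_le_add Finset.card_image_le Finset.card_le_two

end Points

end Spacings

end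

noncomputable section

namespace Spacings

open MeasureTheory

/-! ### Lattice point counts as volumes. -/

section Counting

variable {d : ℕ}

/-- The integer point of the cube of side `t⁻¹` containing `p`. -/
def floorPoint (t : ℝ) (p : Fin d → ℝ) : Fin d → ℤ := fun i => ⌊t * p i⌋

theorem norm_inv_smul_floorPoint_sub_le {t : ℝ} (ht : 0 < t) (p : Fin d → ℝ) :
    ‖t⁻¹ • (fun i => (floorPoint t p i : ℝ)) - p‖ ≤ t⁻¹ := by
  refine (pi_norm_le_iff_of_nonneg (inv_nonneg.2 ht.le)).2 fun i => ?_
  have h1 : (t⁻¹ • (fun i => (floorPoint t p i : ℝ)) - p) i = -(t⁻¹ * Int.fract (t * p i)) := by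
    rw [Pi.sub_apply, Pi.smul_apply, smul_eq_mul, floorPoint, ← Int.self_sub_floor]
    field_simp
    ring
  rw [h1, norm_neg, Real.norm_of_nonneg (mul_nonneg (inv_nonneg.2 ht.le) (Int.fract_nonneg _))]
  exact mul_le_of_le_one_right (inv_nonneg.2 ht.le) (Int.fract_lt_one _).le

/-- The fibres of `floorPoint t` are disjoint cubes of side `t⁻¹`. Counting thus becomes the volume
of a preimage under rounding, a map that moves points by at most `t⁻¹`. -/
theorem measureReal_floorPoint_mem {t : ℝ} (ht : 0 < t) (A : Finset (Fin d → ℤ)) :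
    (volume : Measure (Fin d → ℝ)).real {p | floorPoint t p ∈ A} = A.card / t ^ d := by
  set cube : (Fin d → ℤ) → Set (Fin d → ℝ) := fun m =>
    Set.pi Set.univ fun i => Set.Ico ((m i : ℝ) / t) ((m i + 1 : ℝ) / t)
  have hcube : ∀ m p, p ∈ cube m ↔ floorPoint t p = m := by
    intro m p
    simp only [cube, Set.mem_univ_pi, Set.mem_Ico, funext_iff, floorPoint]
    refine forall_congr' fun i => ?_
    rw [Int.floor_eq_iff, div_le_iff₀ ht, lt_div_iff₀ ht, mul_comm (p i)]
  have hU : {p | floorPoint t p ∈ A} = ⋃ m ∈ A, cube m := by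
    ext p
    simp [hcube]
  have hvol : ∀ m, (volume : Measure (Fin d → ℝ)).real (cube m) = (t ^ d)⁻¹ := by
    intro m
    rw [measureReal_def, Real.volume_pi_Ico_toReal]
    · have : ∀ i, ((m i + 1 : ℝ) / t - (m i : ℝ) / t) = t⁻¹ := fun i => by field_simp; ring
      simp only [this, Finset.prod_const, Finset.card_univ, Fintype.card_fin, inv_pow]
    · intro i
      exact div_le_div_of_nonneg_right (by linarith) ht.le
  have hfin : ∀ m ∈ A, volume (cube m) ≠ ⊤ := fun m _ => by
    rw [Real.volume_pi_Ico]
    exact ENNReal.prod_ne_top fun _ _ => ENNReal.ofReal_ne_top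
  rw [hU, measureReal_biUnion_finset (h := hfin)]
  · simp only [hvol, Finset.sum_const, nsmul_eq_mul]
    rfl
  · intro m _ m' _ hne
    refine Set.disjoint_left.2 fun p hp hp' => hne ?_
    rw [← (hcube m p).1 hp, (hcube m' p).1 hp']
  · exact fun m _ => MeasurableSet.univ_pi fun i => measurableSet_Ico

/-- The numerator `c - h * (N - 2)` is at most `4 + 2 * κ * T` in absolute value: `2` from `c`
against `A`, `2` from the shift of `N`, and `κ * T` from each approximation. The denominator is at
least `T * V / 2`. -/
theorem abs_div_sub_le_of_close {c A N T V h κ : ℝ} (hT : 0 < T) (hV : 0 < V) (h0 : 0 ≤ h)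
    (h1 : h ≤ 1) (hcA : c ≤ A) (hAc : A ≤ c + 2) (hA : |A / T - V * h| ≤ κ) (hN : |N / T - V| ≤ κ)
    (hκ : κ ≤ V / 4) (hTV : 8 ≤ T * V) : |c / (N - 2) - h| ≤ 8 / (T * V) + 4 * κ / V := by
  have hTV0 : 0 < T * V := mul_pos hT hV
  have hκ0 : 0 ≤ κ := (abs_nonneg _).trans hN
  have hA' : |A - T * V * h| ≤ κ * T := by
    have : A - T * V * h = (A / T - V * h) * T := by field_simp
    rw [this, abs_mul, abs_of_pos hT]
    gcongr
  have hN' : |N - T * V| ≤ κ * T := by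
    have : N - T * V = (N / T - V) * T := by field_simp
    rw [this, abs_mul, abs_of_pos hT]
    gcongr
  have hκT : κ * T ≤ T * V / 4 := by nlinarith
  have hNpos : T * V / 2 ≤ N - 2 := by
    have := (abs_le.1 hN').1
    linarith
  have hN2 : 0 < N - 2 := by linarith
  have hnum : |c - h * (N - 2)| ≤ 4 + 2 * (κ * T) := by
    have e1 : |h * (N - T * V)| ≤ κ * T := by
      rw [abs_mul, abs_of_nonneg h0]
      exact (mul_le_of_le_one_left (abs_nonneg _) h1).trans hN'
    obtain ⟨a1, a2⟩ := abs_le.1 e1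
    obtain ⟨b1, b2⟩ := abs_le.1 hA'
    rw [abs_le]
    constructor <;> nlinarith
  have e : c / (N - 2) - h = (c - h * (N - 2)) / (N - 2) := by field_simp
  rw [e, abs_div, abs_of_pos hN2]
  calc |c - h * (N - 2)| / (N - 2) ≤ (4 + 2 * (κ * T)) / (T * V / 2) :=
        div_le_div₀ (by positivity) hnum (by positivity) hNpos
    _ = _ := by field_simp; ring

end Counting

/-! ### Asymptotics for large `t`, then the theorem. -/

section Main

variable {d : ℕ} {Φ : IntermediateField ℚ ℝ} [NumberField Φ] (b : Module.Basis (Fin (d + 1)) ℚ Φ)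

theorem IsScale.mono {Φ : IntermediateField ℚ ℝ} {c C e e' : ℝ} {z : (Φ →+* ℂ) → ℂ}
    (h : IsScale c C e z) (he : e ≤ e') : IsScale c C e' z :=
  ⟨h.conj_eq, h.le_norm, h.norm_le, h.norm_incl_le.trans he⟩

/-- A finite set of ratios, and a Lipschitz function on a torus times a cube which gives their
proportions up to `O(1 / t)`, for large `t`. -/
theorem exists_lipschitz_proportion (hd : 1 ≤ d) {ω : Fin d → ℝ} (hb_zero : ((b 0 : Φ) : ℝ) = 1)
    (hb_succ : ∀ i : Fin d, ((b i.succ : Φ) : ℝ) = ω i)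
    {R : Set (Fin d → ℝ)} (hR : Bornology.IsBounded R) (hc : Convex ℝ R)
    (hi : (interior R).Nonempty) :
    ∃ (F : Finset Φ) (t₀ C₁ K₁ : ℝ) (θ : Fin (d + 1) → ℝ)
      (β : Fin (NumberField.Units.rank Φ) → ℝ)
      (h : (Fin (d + 1) → UnitAddCircle) × (Fin (NumberField.Units.rank Φ) → unitInterval) →
        Φ → ℝ), 1 ≤ t₀ ∧ 0 ≤ C₁ ∧ 0 ≤ K₁ ∧ (∀ p x, 0 ≤ h p x) ∧
      (∀ p, ∀ S : Finset Φ, F ⊆ S → ∑ x ∈ S, h p x = 1) ∧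
      (∀ p q x, |h p x - h q x| ≤ K₁ * dist p q) ∧
      ∀ t : ℝ, t₀ ≤ t →
        (∀ i : ℕ, i + 2 < (M hR t).card → ∃ x ∈ F, gapRatio ω hR t i = (x : ℝ)) ∧
        (3 ≤ (M hR t).card → ∀ x : Φ, |proportion ω hR t (x : ℝ) -
          h (fun j => ((θ j * Real.log t : ℝ) : UnitAddCircle),
            fun j => fractI (β j * Real.log t)) x| ≤ C₁ / t) := by
  classical
  obtain ⟨Z, θ, β, c, C, K, D, hc0, hC, hK, hD, hZ, hZlip, hu⟩ := exists_scale_family b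
  obtain ⟨e, he, F, hF⟩ := exists_hasNeighbours_disp b hb_zero (fun κ hκ => by
    -- The adapted units at small `t` are the contracting multipliers, as `‖σ u‖ ≤ C * t`.
    obtain ⟨u, hu0, huL, hum, -⟩ := hu (κ / (C + 1)) (by positivity)
    refine ⟨u, hu0, huL, fun σ hσ => ?_⟩
    have h1 : ‖σ u / ((κ / (C + 1) : ℝ) : ℂ)‖ ≤ C := by
      rw [hum σ hσ]
      exact (hZ _).norm_le σ hσ
    rw [norm_div, Complex.norm_real, Real.norm_of_nonneg (by positivity),
      div_le_iff₀ (by positivity)] at h1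
    calc ‖σ u‖ ≤ C * (κ / (C + 1)) := h1
      _ = κ * (C / (C + 1)) := by ring
      _ ≤ κ := mul_le_of_le_one_right hκ.le ((div_le_one (by positivity)).2 (by linarith)))
    hR hi hc0 hC
  set L := basisLattice b
  set V := (volume : Measure (Fin d → ℝ)).real R with hVdef
  have hV : 0 < V := by
    refine ENNReal.toReal_pos ?_ hR.measure_lt_top.ne
    exact (Measure.measure_pos_of_nonempty_interior _ hi).ne'
  obtain ⟨K₀, hK₀, hvol⟩ := exists_abs_measureReal_ratioSet_sub_le
    (volume : Measure (Fin d → ℝ)) F hR hc hi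
  obtain ⟨B, hB0, hB⟩ : ∃ B : ℝ, 0 ≤ B ∧ ∀ μ ∈ F, ∀ σ : Φ →+* ℂ, ‖σ μ‖ ≤ B :=
    ⟨∑ μ ∈ F, ∑ σ : Φ →+* ℂ, ‖σ μ‖, Finset.sum_nonneg fun _ _ => Finset.sum_nonneg fun _ _ =>
      norm_nonneg _, fun μ hμ σ => (Finset.single_le_sum (f := fun σ : Φ →+* ℂ => ‖σ μ‖)
        (fun _ _ => norm_nonneg _) (Finset.mem_univ σ)).trans (Finset.single_le_sum
        (f := fun μ => ∑ σ : Φ →+* ℂ, ‖σ μ‖) (fun _ _ => Finset.sum_nonneg fun _ _ =>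
          norm_nonneg _) hμ)⟩
  have hdual := dualSize_nonneg b
  have hZF : ∀ p, HasNeighbours F L R (disp b (Z p)) := fun p => hF _ ((hZ p).mono he.le)
  set h : (Fin (d + 1) → UnitAddCircle) × (Fin (NumberField.Units.rank Φ) → unitInterval) →
    Φ → ℝ := fun p x => (volume : Measure (Fin d → ℝ)).real (ratioSet L R (disp b (Z p)) x) / V
    with hh
  have hh0 : ∀ p x, 0 ≤ h p x := fun p x => div_nonneg measureReal_nonneg hV.le
  have hh1 : ∀ p x, h p x ≤ 1 := fun p x => (div_le_one hV).2
    (measureReal_mono (fun q hq => hq.1) hR.measure_lt_top.ne)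
  -- `Q / t` dominates the rounding error `1 / t` as well as the change of displacement caused by
  -- setting the weight at the inclusion to `0`.
  set Q := 1 + D * B * dualSize b with hQ
  have hQ1 : 1 ≤ Q := by
    have : 0 ≤ D * B * dualSize b := by positivity
    linarith
  set K₂ := K * B * dualSize b with hK₂
  have hK₂0 : 0 ≤ K₂ := by positivity
  -- The summands of the threshold ensure `1 ≤ t`, `D / t ≤ e`, `Q / t ≤ 1`, `K₀ * (Q / t) ≤ V / 4`
  -- and `8 ≤ t ^ d * V`. In the Lipschitz constant the `+ 1` covers parameters too far apart for
  -- the volume estimate, where `0 ≤ h ≤ 1` suffices.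
  refine ⟨quotients F, 1 + D / e + Q + 4 * (K₀ * Q) / V + 8 / V, 8 / V + 4 * (K₀ * Q) / V,
    (K₀ / V + 1) * K₂, θ, β, h, ?_, by positivity, by positivity, hh0, fun p S hS => ?_,
    fun p q x => ?_, fun t ht => ?_⟩
  · have : 0 ≤ D / e + Q + 4 * (K₀ * Q) / V + 8 / V := by positivity
    linarith
  · rw [← Finset.sum_div, sum_measureReal_ratioSet _ hR hc (hZF p) hS, div_self hV.ne']
  · have hclose : ∀ μ ∈ F, ‖disp b (Z p) μ - disp b (Z q) μ‖ ≤ K₂ * dist p q := fun μ hμ => by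
      have := norm_disp_sub_disp_le b (mul_nonneg hK dist_nonneg) hB0 (hZlip p q) (hB μ hμ)
      calc _ ≤ K * dist p q * B * dualSize b := this
        _ = K₂ * dist p q := by rw [hK₂]; ring
    have hδ : 0 ≤ K₂ * dist p q := by positivity
    rcases le_total (K₂ * dist p q) 1 with h1 | h1
    · have h2 := (hvol _ hδ h1 id (fun p => by simpa using hδ)).2 L _ _ (hZF p) (hZF q) hclose x
      rw [hh]
      simp only [id] at h2 ⊢
      rw [← sub_div, abs_div, abs_of_pos hV, div_le_iff₀ hV]
      refine h2.trans ?_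
      have : (K₀ / V + 1) * K₂ * dist p q * V = K₀ * (K₂ * dist p q) + V * (K₂ * dist p q) := by
        field_simp
      rw [this]
      have := mul_nonneg hV.le hδ
      linarith
    · have h2 : |h p x - h q x| ≤ 1 := by
        rw [abs_le]
        constructor <;> linarith [hh0 p x, hh0 q x, hh1 p x, hh1 q x]
      have h3 : 0 ≤ K₀ / V * (K₂ * dist p q) := by positivity
      calc _ ≤ 1 := h2
        _ ≤ K₂ * dist p q + K₀ / V * (K₂ * dist p q) := by linarith
        _ = _ := by ring
  · have p1 : 0 ≤ D / e := by positivity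
    have p2 : 0 ≤ 4 * (K₀ * Q) / V := by positivity
    have p3 : 0 ≤ 8 / V := by positivity
    have ht1 : 1 ≤ t := by linarith
    have ht0 : 0 < t := by linarith
    have htD : D / t ≤ e := by
      rw [div_le_iff₀ ht0, ← div_le_iff₀' he]
      linarith
    have htQ : Q / t ≤ 1 := by
      rw [div_le_one ht0]
      linarith
    have htK : K₀ * (Q / t) ≤ V / 4 := by
      have : 4 * (K₀ * Q) / V ≤ t := by linarith
      rw [div_le_iff₀ hV] at this
      rw [← mul_div_assoc, div_le_iff₀ ht0]
      linarith
    have htd : t ≤ t ^ d := le_self_pow₀ ht1 (by omega)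
    have htV : 8 ≤ t ^ d * V := by
      have : 8 / V ≤ t := by linarith
      rw [div_le_iff₀ hV] at this
      exact this.trans (mul_le_mul_of_nonneg_right htd hV.le)
    obtain ⟨u, hu0, huL, hum, huD⟩ := hu t ht0
    have huD := huD ht1
    set P : (Fin (d + 1) → UnitAddCircle) × (Fin (NumberField.Units.rank Φ) → unitInterval) :=
      (fun j => ((θ j * Real.log t : ℝ) : UnitAddCircle), fun j => fractI (β j * Real.log t))
    set f := disp b fun _ => ((t⁻¹ : ℝ) : ℂ) with hf
    -- The scale `1 / t` after multiplication by `u`: it equals `Z P` off the inclusion, and at the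
    -- inclusion it is at most `D / t` where `Z P` is `0`.
    set z : (Φ →+* ℂ) → ℂ := fun σ => ((t⁻¹ : ℝ) : ℂ) * σ u with hz
    have hzne : ∀ σ, σ ≠ incl Φ → z σ = Z P σ := fun σ hσ => by
      rw [← hum σ hσ, hz, Complex.ofReal_inv, div_eq_inv_mul]
    have hzincl : ‖z (incl Φ)‖ ≤ D / t := by
      rw [hz]
      simp only
      rw [norm_mul, norm_incl, abs_of_pos hu0, Complex.norm_real, norm_inv,
        Real.norm_of_nonneg ht0.le, div_eq_inv_mul]
      gcongr
    have hzscale : IsScale c C e z := by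
      refine ⟨fun σ => ?_, fun σ hσ => ?_, fun σ hσ => ?_, hzincl.trans htD⟩
      · simp only [hz, map_mul, Complex.conj_ofReal, NumberField.ComplexEmbedding.conjugate_coe_eq]
      · rw [hzne σ hσ]
        exact (hZ P).le_norm σ hσ
      · rw [hzne σ hσ]
        exact (hZ P).norm_le σ hσ
    have hzF : HasNeighbours F L R (disp b z) := hF z hzscale
    have hcomp : (fun a => f (u * a)) = disp b z := by
      ext a : 1
      rw [hf, disp_mul]
    have hratio : ∀ p x, HasRatio L R (disp b z) p x ↔ HasRatio L R f p x := fun p x => by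
      rw [← hcomp]
      exact hasRatio_comp_mul hu0 huL
    have hclose : ∀ μ ∈ F, ‖disp b z μ - disp b (Z P) μ‖ ≤ Q / t := fun μ hμ => by
      have h1 := norm_disp_sub_disp_le b (z := z) (w := Z P) (δ := D / t) (by positivity) hB0
        (fun σ => by
          by_cases hσ : σ = incl Φ
          · have h2 : Z P (incl Φ) = 0 := norm_le_zero_iff.1 (hZ P).norm_incl_le
            rw [hσ, h2, sub_zero]
            exact hzincl
          · rw [hzne σ hσ, sub_self, norm_zero]
            positivity) (hB μ hμ)
      calc _ ≤ D / t * B * dualSize b := h1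
        _ = D * B * dualSize b / t := by ring
        _ ≤ Q / t := by gcongr; linarith
    have hφ : ∀ p : Fin d → ℝ, ‖t⁻¹ • (fun i => (floorPoint t p i : ℝ)) - p‖ ≤ Q / t := fun p =>
      (norm_inv_smul_floorPoint_sub_le ht0 p).trans (by rw [inv_eq_one_div]; gcongr)
    obtain ⟨hvol1, hvol2⟩ := hvol (Q / t) (by positivity) htQ _ hφ
    refine ⟨fun i hi' => ?_, fun hcard x => ?_⟩
    · obtain ⟨m, hm, hmy⟩ := exists_fracDot_eq_y (ω := ω) hR (t := t) (i := i + 1) (by omega)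
      obtain ⟨x, hx, hxr⟩ := hzF.exists_hasRatio ((mem_M_iff_inv_smul_mem hR ht0).1 hm)
      exact ⟨x, hx, (gapRatio_eq_iff_hasRatio hR hb_zero hb_succ ht0 hi' hm hmy x).2
        ((hratio _ _).1 hxr)⟩
    · obtain ⟨hle, hge⟩ := card_filter_gapRatio hR hb_zero hb_succ ht0 x
      have hN : |((M hR t).card : ℝ) / t ^ d - V| ≤ K₀ * (Q / t) := by
        rw [← measureReal_floorPoint_mem ht0]
        convert hvol1 using 5
        ext p
        exact mem_M_iff_inv_smul_mem hR ht0
      have hA : |(((M hR t).filter fun m => HasRatio L R f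
          (t⁻¹ • fun i => (m i : ℝ)) x).card : ℝ) / t ^ d - V * h P x| ≤ K₀ * (Q / t) := by
        rw [← measureReal_floorPoint_mem ht0, hh, mul_div_cancel₀ _ hV.ne']
        convert hvol2 L _ _ hzF (hZF P) hclose x using 5
        ext p
        simp only [Set.mem_ofPred_eq, Finset.mem_filter, mem_M_iff_inv_smul_mem hR ht0, ratioSet,
          hratio]
      have hmain := abs_div_sub_le_of_close (pow_pos ht0 d) hV (hh0 P x) (hh1 P x)
        (Nat.cast_le.2 hle) (by exact_mod_cast hge) hA hN htK htV
      rw [proportion, Nat.cast_sub (by omega : 2 ≤ (M hR t).card), Nat.cast_ofNat]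
      refine (le_of_eq_of_le ?_ hmain).trans ?_
      · congr!
      · have h1 : 8 / (t ^ d * V) ≤ 8 / (t * V) := by gcongr
        calc _ ≤ 8 / (t * V) + 4 * (K₀ * (Q / t)) / V := by gcongr
          _ = _ := by field_simp

end Main

end Spacings

end

theorem theoremB (d : ℕ) (hd : 1 ≤ d) (ω : Fin d → ℝ)
    (Φ : IntermediateField ℚ ℝ) [NumberField Φ]
    (b : Module.Basis (Fin (d + 1)) ℚ Φ) (hb_zero : ((b 0 : Φ) : ℝ) = 1)
    (hb_succ : ∀ i : Fin d, ((b i.succ : Φ) : ℝ) = ω i)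
    (r : ℕ) (hr : r = Module.finrank ℤ (Additive (𝓞 Φ)ˣ))
    (R : Set (Fin d → ℝ)) (hR_bdd : Bornology.IsBounded R) (hR_convex : Convex ℝ R)
    (hR_int : (interior R).Nonempty) :
    ∃ S : Finset Φ,
      (∀ t : ℝ, 1 < t → ∀ i : ℕ, i + 2 < (Spacings.M hR_bdd t).card →
        ∃ x ∈ S, Spacings.gapRatio ω hR_bdd t i = (x : ℝ)) ∧
      ∃ k : ℕ, k ≤ d + 1 ∧
      ∃ h : (Fin k → UnitAddCircle) × (Fin r → unitInterval) → stdSimplex ℝ S,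
        (∃ K : ℝ≥0, LipschitzWith K h) ∧
        ∃ (θ : Fin k → ℝ) (β : Fin r → ℝ) (α : ℝ), 0 < α ∧ α < 1 ∧
        ∃ C : ℝ, ∀ t : ℝ, 1 < t → 3 ≤ (Spacings.M hR_bdd t).card → ∀ x : S,
          |Spacings.proportion ω hR_bdd t ((x : Φ) : ℝ) -
            (h (fun j => ((θ j * Real.log t : ℝ) : UnitAddCircle),
                fun j => Spacings.fractI (β j * Real.log t)) : S → ℝ) x|
            ≤ C * α ^ Real.log t := by
  classical
  obtain rfl : r = NumberField.Units.rank Φ := hr.trans (NumberField.Units.finrank_eq Φ)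
  obtain ⟨F, t₀, C₁, K₁, θ, β, h, ht₀, hC₁, hK₁, hh0, hsum, hlip, hmain⟩ :=
    Spacings.exists_lipschitz_proportion b hd hb_zero hb_succ hR_bdd hR_convex hR_int
  obtain ⟨S₀, hS₀⟩ := Spacings.exists_finset_gapRatio hR_bdd hb_zero hb_succ t₀
  have hsum' : ∀ p, ∑ x : (F ∪ S₀ : Finset Φ), h p x = 1 := fun p => by
    rw [← hsum p (F ∪ S₀) Finset.subset_union_left]
    exact Finset.sum_coe_sort (F ∪ S₀) (h p)
  have hh1 : ∀ p, ∀ x : (F ∪ S₀ : Finset Φ), h p x ≤ 1 := fun p x => by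
    rw [← hsum' p]
    exact Finset.single_le_sum (f := fun x : (F ∪ S₀ : Finset Φ) => h p x)
      (fun _ _ => hh0 _ _) (Finset.mem_univ x)
  -- `S₀` collects the ratios for `t ≤ t₀`; enlarging `F` is harmless, since the sum of `h p` over
  -- any finite set containing `F` is `1`.
  refine ⟨F ∪ S₀, fun t ht i hi => ?_, d + 1, le_rfl,
    fun p => ⟨fun x => h p x, fun x => hh0 _ _, hsum' p⟩, ⟨K₁.toNNReal, ?_⟩, θ, β, Real.exp (-1),
    Real.exp_pos _, (Real.exp_lt_exp.2 (by norm_num : (-1 : ℝ) < 0)).trans_eq Real.exp_zero, C₁ + t₀,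
    fun t ht hcard x => ?_⟩
  · rcases le_total t₀ t with h1 | h1
    · obtain ⟨x, hx, e⟩ := (hmain t h1).1 i hi
      exact ⟨x, Finset.mem_union_left _ hx, e⟩
    · obtain ⟨x, hx, e⟩ := hS₀ t (by linarith) h1 i hi
      exact ⟨x, Finset.mem_union_right _ hx, e⟩
  · refine LipschitzWith.of_dist_le_mul fun p q => ?_
    rw [Real.coe_toNNReal _ hK₁]
    refine (dist_pi_le_iff (mul_nonneg hK₁ dist_nonneg)).2 fun x => ?_
    rw [Real.dist_eq]
    exact hlip p q x
  · have ht0 : 0 < t := by linarith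
    have hexp : Real.exp (-1) ^ Real.log t = t⁻¹ := by
      rw [← Real.exp_mul, neg_one_mul, Real.exp_neg, Real.exp_log ht0]
    rw [hexp, ← div_eq_mul_inv]
    rcases le_total t₀ t with h1 | h1
    · refine ((hmain t h1).2 hcard x).trans ?_
      gcongr
      linarith
    -- For `t ≤ t₀` the summand `t₀` of the constant makes the bound at least `1`, and two numbers
    -- in `[0, 1]` differ by at most `1`.
    · refine le_trans ?_ ((one_le_div ht0).2 (by linarith : t ≤ C₁ + t₀))
      have h2 : 0 ≤ Spacings.proportion ω hR_bdd t ((x : Φ) : ℝ) := by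
        unfold Spacings.proportion
        positivity
      have h3 : Spacings.proportion ω hR_bdd t ((x : Φ) : ℝ) ≤ 1 := by
        refine div_le_one_of_le₀ ?_ (Nat.cast_nonneg _)
        exact_mod_cast (Finset.card_filter_le _ _).trans (Finset.card_range _).le
      set P : (Fin (d + 1) → UnitAddCircle) × (Fin (NumberField.Units.rank Φ) → unitInterval) :=
        (fun j => ((θ j * Real.log t : ℝ) : UnitAddCircle),
          fun j => Spacings.fractI (β j * Real.log t))
      have h4 := hh0 P x
      have h5 := hh1 P x
      change |Spacings.proportion ω hR_bdd t ((x : Φ) : ℝ) - h P x| ≤ 1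
      rw [abs_le]
      constructor <;> linarith
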